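/- **Setting.** Let $d\ge 1$, let $x,y\in\mathbb S^{d-1}$ be unit vectors in $\mathbb R^d$, and let $R$ be a Haar-distributed random orthogonal $d\times d$ matrix. A $b$-bit *Lloyd–Max codebook* of a probability law $\mu$ on $\mathbb R$ is a set of $2^b$ centroids $a_i\in\mathbb R$ minimizing $\mathbb E_{Z\sim\mu}[\min_i (Z-a_i)^2]$. Given a scalar codebook, let $\bar x=R^\top q(Rx)$, where $q$ replaces each coordinate by a nearest centroid (ties broken by any measurable rule). * $b$-bit $\mathrm{EDEN_{UB}}$: the codebook is $d^{-1/2}$ times a $b$-bit Lloyd–Max codebook of $N(0,1)$, and the estimate of $\langle x,y\rangle$ is $\mathrm{IP}^{(b)}_{\mathrm{EDEN}}(x,y)=\langle \bar x/\langle x,\bar x\rangle,\,y\rangle$. * $b$-bit $\mathrm{TurboQuant_{PROD}}$: the codebook is a $(b-1)$-bit Lloyd–Max codebook of the law of a coordinate of a uniform random point of $\mathbb S^{d-1}$, and, with $r=x-\bar x$ and a $d\times d$ matrix $S$ of i.i.d. standard Gaussian entries independent of $R$, the estimate is $\mathrm{IP}^{(b)}_{\mathrm{TQ}}(x,y)=\langle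 y,\bar x\rangle+\frac{\sqrt{\pi/2}}{d}\|r\|_2\,\langle Sy,\operatorname{sign}(Sr)\rangle$. **Theorem.** For $\mathrm{EDEN_{UB}}$ there are universal constants $C,c,m,M>0$ such that the following hold. 1. If $0<\delta<1$ and $\log(4/\delta)\le cd$, then for every bit-width $b\ge1$ and all $x,y\in\mathbb S^{d-1}$, $$\mathbb P\left[\left|\mathrm{IP}^{(b)}_{\mathrm{EDEN}}(x,y)-\langle x,y\rangle\right|>C\left(2^{-b}\sqrt{\frac{\log(4/\delta)}{d}}+\frac{\log(4/\delta)}{d}\right)\right]\le\delta .$$ 2. If $0<\epsilon,\delta<1$ and $\epsilon\ge C\log(4/\delta)/d$, then for every $$b\ge\max\left\{1,\left\lceil\tfrac12\log_2\left(\frac{C\log(4/\delta)}{d\epsilon^2}\right)\right\rceil\right\}$$ and all $x,y\in\mathbb S^{d-1}$, $\ \mathbb P\left[\left|\mathrm{IP}^{(b)}_{\mathrm{EDEN}}(x,y)-\langle x,y\rangle\right|>\epsilon\right]\le\delta$. 3. Hence $b=\Theta\left(\log\left(\frac1{d\epsilon^2}\log\frac1\delta\right)\right)$ bits per dimension suffice,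 in the following sense. Put $X=\frac{1}{d\epsilon^2}\log\frac1\delta$. If $0<\epsilon<1$, $0<\delta\le\frac12$, $\epsilon\ge M\log(1/\delta)/d$ and $X\ge2$, then there is an integer $b_0\ge1$ with $m\log X\le b_0\le M\log X$ such that for every $b\ge b_0$ and all $x,y\in\mathbb S^{d-1}$, $\ \mathbb P\left[\left|\mathrm{IP}^{(b)}_{\mathrm{EDEN}}(x,y)-\langle x,y\rangle\right|>\epsilon\right]\le\delta$. The same holds for $\mathrm{TurboQuant_{PROD}}$ (with $\mathrm{IP}^{(b)}_{\mathrm{TQ}}$ in place of $\mathrm{IP}^{(b)}_{\mathrm{EDEN}}$, and possibly other constants), with $2^{-(b-1)}$ in place of $2^{-b}$ in 1, and with the bit-width condition $$b\ge1+\max\left\{0,\left\lceil\tfrac12\log_2\left(\frac{C\log(4/\delta)}{d\epsilon^2}\right)\right\rceil\right\}$$ in 2. -/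

import Mathlib

open MeasureTheory ProbabilityTheory

noncomputable section

/-! ### The random rotation -/

/-- `O(d)`, with its subspace topology inherited from the matrices. -/
abbrev OrthGroup (d : ℕ) := Matrix.orthogonalGroup (Fin d) ℝ

instance OrthGroup.instMeasurableSpace (d : ℕ) : MeasurableSpace (OrthGroup d) :=
  borel (OrthGroup d)

instance OrthGroup.instBorelSpace (d : ℕ) : BorelSpace (OrthGroup d) := ⟨rfl⟩

instance OrthGroup.instCompactSpace (d : ℕ) : CompactSpace (OrthGroup d) := by
  have hclosed : IsClosed {A : Matrix (Fin d) (Fin d) ℝ | A ∈ Matrix.orthogonalGroup (Fin d) ℝ} := by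
    have : {A : Matrix (Fin d) (Fin d) ℝ | A ∈ Matrix.orthogonalGroup (Fin d) ℝ}
        = {A | A * star A = 1} := by
      ext A
      exact Matrix.mem_orthogonalGroup_iff (Fin d) ℝ
    rw [this]
    exact isClosed_eq (by fun_prop) continuous_const
  have hsub : {A : Matrix (Fin d) (Fin d) ℝ | A ∈ Matrix.orthogonalGroup (Fin d) ℝ}
      ⊆ Set.pi Set.univ fun _ : Fin d => Set.pi Set.univ fun _ : Fin d => Set.Icc (-1 : ℝ) 1 := by
    intro A hA i _ j _
    have h := entry_norm_bound_of_unitary hA i j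
    rw [Real.norm_eq_abs] at h
    exact abs_le.mp h
  exact isCompact_iff_compactSpace.mp
    ((isCompact_univ_pi fun _ => isCompact_univ_pi fun _ => isCompact_Icc).of_isClosed_subset
      hclosed hsub)

/-- The Haar probability measure on `O(d)`: the Haar measure giving mass `1` to the whole group. -/
def haarO (d : ℕ) : Measure (OrthGroup d) := Measure.haarMeasure ⊤

/-- The rotated vector `R x`. -/
def rot {d : ℕ} (R : OrthGroup d) (x : EuclideanSpace ℝ (Fin d)) : EuclideanSpace ℝ (Fin d) :=
  Matrix.toEuclideanLin (R : Matrix (Fin d) (Fin d) ℝ) x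

/-- The inverse rotation `Rᵀ z`. -/
def rotInv {d : ℕ} (R : OrthGroup d) (z : EuclideanSpace ℝ (Fin d)) : EuclideanSpace ℝ (Fin d) :=
  Matrix.toEuclideanLin (R : Matrix (Fin d) (Fin d) ℝ).transpose z

/-! ### Scalar codebooks -/

/-- `a` lists the centroids of a `K`-level Lloyd--Max (that is, mean-squared-error optimal)
scalar codebook for the law `μ`: it minimizes `E[min_i (Z - a_i)²]`, `Z ∼ μ`, among all lists of
`K` real centroids. -/
def IsLloydMax (μ : Measure ℝ) {K : ℕ} (a : Fin K → ℝ) : Prop :=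
  ∀ a' : Fin K → ℝ, ∫ z, (⨅ i, (z - a i) ^ 2) ∂μ ≤ ∫ z, (⨅ i, (z - a' i) ^ 2) ∂μ

/-- `enc` maps a real number to the index of a nearest centroid
(with any measurable rule for breaking ties). -/
def IsNearestCode {K : ℕ} (a : Fin K → ℝ) (enc : ℝ → Fin K) : Prop :=
  Measurable enc ∧ ∀ (r : ℝ) (j : Fin K), |r - a (enc r)| ≤ |r - a j|

/-- The uniform probability measure on the unit sphere of `ℝ^d`: normalized surface measure. -/
def sphereUniform (d : ℕ) : Measure (Metric.sphere (0 : EuclideanSpace ℝ (Fin d)) 1) :=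
  ((volume : Measure (EuclideanSpace ℝ (Fin d))).toSphere Set.univ)⁻¹ •
    (volume : Measure (EuclideanSpace ℝ (Fin d))).toSphere

/-- The law of the `j`-th coordinate of a uniform point of the unit sphere of `ℝ^d`. -/
def sphereCoordLaw {d : ℕ} (j : Fin d) : Measure ℝ :=
  (sphereUniform d).map fun v : Metric.sphere (0 : EuclideanSpace ℝ (Fin d)) 1 =>
    (v : EuclideanSpace ℝ (Fin d)) j

/-! ### Coordinate-wise quantization after a rotation -/

/-- Encoding: with `K = 2 ^ b` centroids the code consists of `b` bits per coordinate. -/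
def encodeVec {d K : ℕ} (enc : ℝ → Fin K) (z : EuclideanSpace ℝ (Fin d)) : Fin d → Fin K :=
  fun j => enc (z j)

/-- Decoding: every index is replaced by its centroid. -/
def decodeVec {d K : ℕ} (a : Fin K → ℝ) (k : Fin d → Fin K) : EuclideanSpace ℝ (Fin d) :=
  WithLp.toLp 2 fun j => a (k j)

/-- The raw reconstruction `x̄ = Rᵀ P_decode (P_code (R x))`. -/
def rawRec {d K : ℕ} (a : Fin K → ℝ) (enc : ℝ → Fin K) (R : OrthGroup d)
    (x : EuclideanSpace ℝ (Fin d)) : EuclideanSpace ℝ (Fin d) :=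
  rotInv R (decodeVec a (encodeVec enc (rot R x)))

/-! ### The unbiased EDEN estimator -/

/-- `a` and `enc` are the codebook and the encoder of `b`-bit EDEN in dimension `d`:
`a` is a Lloyd--Max codebook with `2 ^ b` levels of the standard normal law, scaled by `1 / √d`. -/
def IsEdenCode (d b : ℕ) (a : Fin (2 ^ b) → ℝ) (enc : ℝ → Fin (2 ^ b)) : Prop :=
  (∃ q : Fin (2 ^ b) → ℝ, IsLloydMax (gaussianReal 0 1) q ∧ ∀ i, a i = q i / √d) ∧
    IsNearestCode a enc

/-- The inner-product estimate `⟨x̂, y⟩` of the unbiased EDEN, with `x̂ = x̄ / ⟨x, x̄⟩`. -/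
def edenIP {d K : ℕ} (a : Fin K → ℝ) (enc : ℝ → Fin K) (R : OrthGroup d)
    (x y : EuclideanSpace ℝ (Fin d)) : ℝ :=
  inner ℝ ((1 / inner ℝ x (rawRec a enc R x)) • rawRec a enc R x) y

/-- For all unit vectors `x, y ∈ ℝ^d`, the inner-product error of `b`-bit unbiased EDEN exceeds `t`
with probability at most `δ` over the random rotation. -/
def EdenErrorBound (d b : ℕ) (t δ : ℝ) : Prop :=
  ∀ (a : Fin (2 ^ b) → ℝ) (enc : ℝ → Fin (2 ^ b)), IsEdenCode d b a enc →
    ∀ x y : EuclideanSpace ℝ (Fin d), ‖x‖ = 1 → ‖y‖ = 1 →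
      (haarO d).real {R | t < |edenIP a enc R x y - inner ℝ x y|} ≤ δ

/-! ### The TurboQuant inner-product estimator -/

/-- `a` and `enc` are the codebook and the encoder of `b`-bit mean-squared-error TurboQuant in
dimension `d`: `a` is a Lloyd--Max codebook with `2 ^ b` levels of the law of a coordinate of a
uniform point of the sphere. (By symmetry this law does not depend on the coordinate.) -/
def IsTurboCode (d b : ℕ) (a : Fin (2 ^ b) → ℝ) (enc : ℝ → Fin (2 ^ b)) : Prop :=
  (∀ j : Fin d, IsLloydMax (sphereCoordLaw j) a) ∧ IsNearestCode a enc

/-- The law of a `d × d` matrix (given by its rows) with independent standard normal entries. -/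
def gaussianMatrix (d : ℕ) : Measure (Fin d → Fin d → ℝ) :=
  Measure.pi fun _ => Measure.pi fun _ => gaussianReal 0 1

/-- The one-bit QJL code of `r`: the signs of the coordinates of `S r`. -/
def qjlEncode {d : ℕ} (S : Fin d → Fin d → ℝ) (r : EuclideanSpace ℝ (Fin d)) : Fin d → Bool :=
  fun i => decide (0 ≤ ∑ k, S i k * r k)

/-- The QJL estimate `(√(π/2) / d) ‖r‖ ⟨S y, sign (S r)⟩` of `⟨y, r⟩`. -/
def qjlIP {d : ℕ} (S : Fin d → Fin d → ℝ) (y r : EuclideanSpace ℝ (Fin d)) : ℝ :=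
  √(Real.pi / 2) / d * ‖r‖ *
    ∑ i, (∑ k, S i k * y k) * (if qjlEncode S r i then 1 else -1)

/-- The TurboQuant inner-product estimate: the inner product with the raw reconstruction `x̄`, plus
the QJL estimate of the inner product with the residual `x - x̄`. -/
def turboIP {d K : ℕ} (a : Fin K → ℝ) (enc : ℝ → Fin K) (R : OrthGroup d)
    (S : Fin d → Fin d → ℝ) (x y : EuclideanSpace ℝ (Fin d)) : ℝ :=
  inner ℝ y (rawRec a enc R x) + qjlIP S y (x - rawRec a enc R x)

/-- For all unit vectors `x, y ∈ ℝ^d`, the error of the `b`-bit TurboQuant inner-product estimate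
(`b - 1` bits per dimension for the raw reconstruction and one for the residual) exceeds `t`
with probability at most `δ` over the independent random rotation and Gaussian matrix. -/
def TurboErrorBound (d b : ℕ) (t δ : ℝ) : Prop :=
  ∀ (a : Fin (2 ^ (b - 1)) → ℝ) (enc : ℝ → Fin (2 ^ (b - 1))), IsTurboCode d (b - 1) a enc →
    ∀ x y : EuclideanSpace ℝ (Fin d), ‖x‖ = 1 → ‖y‖ = 1 →
      ((haarO d).prod (gaussianMatrix d)).real
        {ω | t < |turboIP a enc ω.1 ω.2 x y - inner ℝ x y|} ≤ δ

end

/-!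
Both estimators quantize the coordinates of `u = R x`, a uniformly random point of the sphere, and
both errors are governed by the norm of the residual `q(u) - u`.

*The residual.* Write `u` as the direction of a Gaussian vector `g` (`haarO_rot_mem_eq_stdG`). With
`D` the distance to the codebook scaled by `√d`, `√d * ‖q(u) - u‖` is the norm of the vector with
entries `D (√d * u i)`; as `D` is `1`-Lipschitz, replacing `√d • u` by `g` costs at most `|√d - ‖g‖|`,
which is of order `√(log (1 / δ))`. It remains to control `∑ i, D (g i) ^ 2`, a sum of independent
terms with mean `m = E D(Z)²`. The point is that `E exp (l * D(Z) ^ 2) ≤ exp (l * m * (1 + O(l)))`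
with an exponent linear in `m`, although nothing is known about `D` but its Lipschitz constant
(`integrable_and_integral_exp_mul_sq_le`). This follows from `E[D² exp (D² / 8)] ≤ κ * m`, which is
proved by transport: moving `z` towards the origin by `D z / 2` is an antilipschitz map that keeps
`D` up to a factor `2` and increases the Gaussian density by at least `exp (D z ^ 2 / 8)`
(`sq_mul_exp_mul_pdf_le`). Chernoff's bound then gives
`‖q(u) - u‖ ≤ C * (√m + √(log (4 / δ) / d))` with high probability (`haarO_residual_tail`).

*The mean squared error.* A codebook at the points `±log (n / i)` is within `exp |z| / n` of `z`, so
`m ≤ C / 4 ^ b` for an optimal Gaussian codebook, and two levels already give `m ≤ 1 - 2 / π`. An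
optimal codebook for the sphere is compared with the same points through the coupling of `u` and
`g`, at the cost of an additive `C / d` (`IsTurboCode.gaussian_mse_le`).

*EDEN.* If `z` is the part of `y` orthogonal to `x`, the error is
`⟪q(u) - u, R z⟫ / ⟪u, q(u)⟫` (`abs_edenIP_sub_le`). The denominator is at least `1 / 4` once
`‖q(u) - u‖² ≤ 1 / 2`, and given `u` the vector `R z` points in a uniformly random direction
orthogonal to `u` (`haarO_inner_rot_le`), which contributes a factor `√(log (4 / δ) / d)`.

*TurboQuant.* Given the rotation, the error is that of the QJL estimate of `⟪y, r⟫` for the fixed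
residual `r`, an average of `d` independent centered sub-Gaussian terms of size `‖r‖`
(`gaussianMatrix_qjlIP_tail`).

The bit-widths follow by solving the error bound for `b` (`exists_bits_of_errorBound`).
-/

open scoped NNReal ENNReal

variable {d : ℕ}

/-! ### Integrals against the standard normal law -/

lemma gaussianPDFReal_std (z : ℝ) :
    gaussianPDFReal 0 1 z = (√(2 * Real.pi))⁻¹ * Real.exp (-z ^ 2 / 2) := by
  simp [gaussianPDFReal]

lemma integrable_gaussianReal_iff {f : ℝ → ℝ} :
    Integrable f (gaussianReal 0 1) ↔
      Integrable (fun z => gaussianPDFReal 0 1 z * f z) := by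
  rw [gaussianReal_of_var_ne_zero _ one_ne_zero, integrable_withDensity_iff_integrable_smul'
    (by fun_prop) (Filter.Eventually.of_forall fun x => gaussianPDF_lt_top)]
  simp [toReal_gaussianPDF]

lemma gaussianPDFReal_mul_exp_sq (l z : ℝ) :
    gaussianPDFReal 0 1 z * Real.exp (l * z ^ 2)
      = (√(2 * Real.pi))⁻¹ * Real.exp (-(1 / 2 - l) * z ^ 2) := by
  rw [gaussianPDFReal_std, mul_assoc, ← Real.exp_add]
  ring_nf

lemma integrable_exp_mul_sq {l : ℝ} (hl : l < 1 / 2) :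
    Integrable (fun z => Real.exp (l * z ^ 2)) (gaussianReal 0 1) := by
  rw [integrable_gaussianReal_iff]
  simp_rw [gaussianPDFReal_mul_exp_sq]
  exact (integrable_exp_neg_mul_sq (by linarith)).const_mul _

lemma integral_exp_mul_sq {l : ℝ} (hl : l < 1 / 2) :
    ∫ z, Real.exp (l * z ^ 2) ∂(gaussianReal 0 1) = (√(1 - 2 * l))⁻¹ := by
  rw [integral_gaussianReal_eq_integral_smul one_ne_zero]
  simp_rw [smul_eq_mul, gaussianPDFReal_mul_exp_sq]
  rw [integral_const_mul, integral_gaussian, ← Real.sqrt_inv, ← Real.sqrt_inv,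
    ← Real.sqrt_mul (by positivity)]
  congr 1
  have : (1 - 2 * l) ≠ 0 := by linarith
  have h2 : (1 / 2 - l) ≠ 0 := by linarith
  field_simp

lemma integrable_abs_gaussianReal : Integrable (fun z => |z|) (gaussianReal 0 1) :=
  ((memLp_id_gaussianReal (μ := 0) (v := 1) 1).integrable le_rfl).abs

lemma integral_abs_gaussianReal :
    ∫ z, |z| ∂(gaussianReal 0 1) = √(2 / Real.pi) := by
  rw [integral_gaussianReal_eq_integral_smul one_ne_zero]
  have h1 : ∀ z : ℝ, gaussianPDFReal 0 1 z • |z|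
      = (fun t : ℝ => (√(2 * Real.pi))⁻¹ * (t * Real.exp (-t ^ 2 / 2))) |z| := by
    intro z
    simp only [smul_eq_mul, gaussianPDFReal_std, sq_abs]
    ring
  simp_rw [h1]
  rw [integral_comp_abs (f := fun t : ℝ => (√(2 * Real.pi))⁻¹ * (t * Real.exp (-t ^ 2 / 2))),
    integral_const_mul]
  have h2 : ∫ t in Set.Ioi (0 : ℝ), t * Real.exp (-t ^ 2 / 2) = 1 := by
    have h := integral_rpow_mul_exp_neg_mul_rpow (p := 2) (q := 1) (b := 1 / 2) (by norm_num)
      (by norm_num) (by norm_num)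
    have e : ∀ t : ℝ, t * Real.exp (-t ^ 2 / 2)
        = t ^ (1 : ℝ) * Real.exp (-(1 / 2) * t ^ (2 : ℝ)) := by
      intro t
      rw [Real.rpow_one, Real.rpow_two]
      ring_nf
    simp_rw [e, h]
    norm_num [Real.rpow_neg_one]
  rw [h2, mul_one, Real.sqrt_div (by norm_num), Real.sqrt_mul (by norm_num)]
  have : √(2 : ℝ) * √2 = 2 := Real.mul_self_sqrt (by norm_num)
  field_simp
  nlinarith

lemma integrable_sq_gaussianReal : Integrable (fun z => z ^ 2) (gaussianReal 0 1) :=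
  (memLp_id_gaussianReal (μ := 0) (v := 1) 2).integrable_sq

lemma integral_sq_gaussianReal : ∫ z, z ^ 2 ∂(gaussianReal 0 1) = 1 := by
  have h := variance_fun_id_gaussianReal (μ := 0) (v := 1)
  rw [variance_eq_integral (by fun_prop)] at h
  simpa using h

lemma inv_sqrt_one_sub_le {l : ℝ} (hl : |l| ≤ 1 / 4) :
    (√(1 - 2 * l))⁻¹ ≤ Real.exp (l + 2 * l ^ 2) := by
  obtain ⟨h1, h2⟩ := abs_le.mp hl
  have hpos : 0 < 1 - 2 * l := by linarith
  have key : 1 ≤ (1 - 2 * l) * Real.exp (2 * l + 4 * l ^ 2) := by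
    rcases le_total l 0 with h | h
    · have := Real.add_one_le_exp (2 * l + 4 * l ^ 2)
      nlinarith [mul_nonneg (neg_nonneg.2 h) (sq_nonneg l)]
    · have := Real.quadratic_le_exp_of_nonneg (x := 2 * l + 4 * l ^ 2) (by positivity)
      have h3 : (1 - 2 * l) * (1 + (2 * l + 4 * l ^ 2) + (2 * l + 4 * l ^ 2) ^ 2 / 2)
          ≤ (1 - 2 * l) * Real.exp (2 * l + 4 * l ^ 2) :=
        mul_le_mul_of_nonneg_left this hpos.le
      refine le_trans ?_ h3
      have : (1 - 2 * l) * (1 + (2 * l + 4 * l ^ 2) + (2 * l + 4 * l ^ 2) ^ 2 / 2) - 1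
        = 2 * l ^ 2 * ((1 - 2 * l) * (1 + 2 * l) ^ 2 - 4 * l) := by ring
      have h4 : 0 ≤ (1 - 2 * l) * (1 + 2 * l) ^ 2 - 4 * l := by nlinarith [mul_nonneg h h]
      nlinarith [mul_nonneg (sq_nonneg l) h4]
  have e : Real.exp (2 * l + 4 * l ^ 2) = Real.exp (l + 2 * l ^ 2) ^ 2 := by
    rw [← Real.exp_nat_mul]; congr 1; push_cast; ring
  rw [e] at key
  rw [inv_le_iff_one_le_mul₀ (by positivity)]
  have : 1 ≤ (Real.exp (l + 2 * l ^ 2) * √(1 - 2 * l)) ^ 2 := by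
    rw [mul_pow, Real.sq_sqrt hpos.le]; linarith
  exact (one_le_sq_iff₀ (by positivity)).mp this

lemma exp_mul_sq_sub_one (l z : ℝ) :
    Real.exp (l * (z ^ 2 - 1)) = Real.exp (-l) * Real.exp (l * z ^ 2) := by
  rw [← Real.exp_add]; ring_nf

lemma integrable_exp_mul_sq_sub_one {l : ℝ} (hl : |l| ≤ 1 / 4) :
    Integrable (fun z => Real.exp (l * (z ^ 2 - 1))) (gaussianReal 0 1) := by
  simp_rw [exp_mul_sq_sub_one]
  exact (integrable_exp_mul_sq (by linarith [(abs_le.mp hl).2])).const_mul _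

/-- Centered squares of standard normal variables are sub-exponential. -/
lemma integral_exp_mul_sq_sub_one_le {l : ℝ} (hl : |l| ≤ 1 / 4) :
    ∫ z, Real.exp (l * (z ^ 2 - 1)) ∂(gaussianReal 0 1) ≤ Real.exp (2 * l ^ 2) := by
  simp_rw [exp_mul_sq_sub_one]
  rw [integral_const_mul, integral_exp_mul_sq (by linarith [(abs_le.mp hl).2])]
  calc _ ≤ Real.exp (-l) * Real.exp (l + 2 * l ^ 2) := by
        gcongr; exact inv_sqrt_one_sub_le hl
    _ = _ := by rw [← Real.exp_add]; ring_nf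

/-! ### Exponential moments of a Lipschitz function of a Gaussian variable -/

/-- A map that shrinks distances by a factor of at most `c` increases volumes of preimages by a
factor of at most `c`. -/
lemma AntilipschitzWith.lintegral_comp_le {τ : ℝ → ℝ} {c : ℝ≥0} (hτ : AntilipschitzWith c τ)
    (hm : Measurable τ) {f : ℝ → ℝ≥0∞} (hf : Measurable f) :
    ∫⁻ z, f (τ z) ≤ c * ∫⁻ z, f z := by
  have hle : (volume : Measure ℝ).map τ ≤ (c : ℝ≥0∞) • volume := by
    refine Measure.le_iff.2 fun s hs => ?_
    rw [Measure.map_apply hm hs, Measure.smul_apply, smul_eq_mul]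
    have := hτ.hausdorffMeasure_preimage_le (d := 1) zero_le_one s
    rwa [hausdorffMeasure_real, ENNReal.rpow_one] at this
  calc ∫⁻ z, f (τ z) = ∫⁻ z, f z ∂((volume : Measure ℝ).map τ) := (lintegral_map hf hm).symm
    _ ≤ ∫⁻ z, f z ∂((c : ℝ≥0∞) • (volume : Measure ℝ)) := lintegral_mono' hle le_rfl
    _ = _ := by rw [lintegral_smul_measure, smul_eq_mul]

lemma antilipschitz_add_half {D : ℝ → ℝ} (hD : LipschitzWith 1 D) {s : ℝ} (hs : |s| ≤ 1 / 2) :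
    AntilipschitzWith 2 fun z => z + s * D z := by
  refine AntilipschitzWith.of_le_mul_dist fun x y => ?_
  have h := hD.dist_le_mul x y
  simp only [Real.dist_eq, NNReal.coe_one, one_mul, NNReal.coe_ofNat] at h ⊢
  have h1 : |x - y| ≤ |x + s * D x - (y + s * D y)| + |s * (D x - D y)| := by
    have := abs_sub (x + s * D x - (y + s * D y)) (s * (D x - D y))
    refine le_trans (le_of_eq ?_) this
    congr 1; ring
  rw [abs_mul] at h1
  nlinarith [mul_le_mul hs h (abs_nonneg _) (by norm_num), abs_nonneg (x - y)]

/-- The Gaussian mass picked up by shifting `z` towards the origin by half of `D z` pays for the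
factor `exp (D z ^ 2 / 8)`. -/
lemma sq_mul_exp_mul_pdf_le {D : ℝ → ℝ} (hD : LipschitzWith 1 D) (h0 : ∀ z, 0 ≤ D z) {M : ℝ}
    (hM : D 0 ^ 2 ≤ 2 * M + 2) (z : ℝ) :
    D z ^ 2 * Real.exp (D z ^ 2 / 8) * gaussianPDFReal 0 1 z ≤
      Real.exp (M + 1) * (D z ^ 2 * gaussianPDFReal 0 1 z)
      + 4 * (D (z + (-1 / 2) * D z) ^ 2 * gaussianPDFReal 0 1 (z + (-1 / 2) * D z))
      + 4 * (D (z + 1 / 2 * D z) ^ 2 * gaussianPDFReal 0 1 (z + 1 / 2 * D z)) := by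
  have hpdf := fun w => gaussianPDFReal_nonneg 0 1 w
  have t1 : 0 ≤ Real.exp (M + 1) * (D z ^ 2 * gaussianPDFReal 0 1 z) :=
    mul_nonneg (Real.exp_pos _).le (mul_nonneg (sq_nonneg _) (hpdf _))
  have t2 : ∀ w, 0 ≤ 4 * (D w ^ 2 * gaussianPDFReal 0 1 w) := fun w =>
    mul_nonneg (by norm_num) (mul_nonneg (sq_nonneg _) (hpdf _))
  have hl : ∀ x y, D x ≤ D y + |x - y| := by
    intro x y
    have h := hD.dist_le_mul x y
    simp only [Real.dist_eq, NNReal.coe_one, one_mul] at h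
    linarith [(abs_le.mp h).2]
  -- the shifted point `w` satisfies `w² + D(z)²/4 ≤ z²`
  have shift : ∀ w, |z - w| = D z / 2 → w ^ 2 + D z ^ 2 / 4 ≤ z ^ 2 →
      D z ^ 2 * Real.exp (D z ^ 2 / 8) * gaussianPDFReal 0 1 z
        ≤ 4 * (D w ^ 2 * gaussianPDFReal 0 1 w) := by
    intro w hw hzw
    have h1 : D z ≤ 2 * D w := by linarith [hl z w]
    have h2 : D z ^ 2 ≤ 4 * D w ^ 2 := by nlinarith [h0 z, h0 w]
    have h3 : Real.exp (D z ^ 2 / 8) * gaussianPDFReal 0 1 z ≤ gaussianPDFReal 0 1 w := by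
      rw [gaussianPDFReal_std, gaussianPDFReal_std, mul_left_comm, ← Real.exp_add]
      gcongr
      linarith
    calc _ = D z ^ 2 * (Real.exp (D z ^ 2 / 8) * gaussianPDFReal 0 1 z) := by ring
      _ ≤ (4 * D w ^ 2) * gaussianPDFReal 0 1 w := by
        apply mul_le_mul h2 h3 (mul_nonneg (Real.exp_pos _).le (hpdf _)) (by positivity)
      _ = _ := by ring
  -- otherwise the shift would cross the origin, but then `D z ≤ 2 * D 0` is bounded
  by_cases hz : |z| ≤ D z / 2
  · have h1 : D z ≤ 2 * D 0 := by
      have := hl z 0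
      rw [sub_zero] at this
      linarith
    have h2 : D z ^ 2 / 8 ≤ M + 1 := by nlinarith [h0 z, h0 0]
    have : D z ^ 2 * Real.exp (D z ^ 2 / 8) * gaussianPDFReal 0 1 z
        ≤ Real.exp (M + 1) * (D z ^ 2 * gaussianPDFReal 0 1 z) := by
      rw [mul_comm (D z ^ 2), mul_assoc]
      gcongr
      exact mul_nonneg (sq_nonneg _) (hpdf _)
    linarith [t2 (z + (-1 / 2) * D z), t2 (z + 1 / 2 * D z)]
  · rw [not_le] at hz
    have hDz := h0 z
    rcases lt_max_iff.mp (hz : D z / 2 < max z (-z)) with h | h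
    · have := shift (z + (-1 / 2) * D z)
        (by rw [show z - (z + (-1 / 2) * D z) = D z / 2 by ring, abs_of_nonneg (by linarith)])
        (by nlinarith)
      linarith [t2 (z + 1 / 2 * D z)]
    · have := shift (z + 1 / 2 * D z)
        (by rw [show z - (z + 1 / 2 * D z) = -(D z / 2) by ring, abs_neg,
              abs_of_nonneg (by linarith)])
        (by nlinarith)
      linarith [t2 (z + (-1 / 2) * D z)]

lemma lintegral_gaussianReal {f : ℝ → ℝ} (hf : Measurable f) (h0 : ∀ z, 0 ≤ f z) :
    ∫⁻ z, ENNReal.ofReal (f z) ∂(gaussianReal 0 1)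
      = ∫⁻ z, ENNReal.ofReal (f z * gaussianPDFReal 0 1 z) := by
  rw [gaussianReal_of_var_ne_zero _ one_ne_zero,
    lintegral_withDensity_eq_lintegral_mul _ (by fun_prop) (by fun_prop)]
  refine lintegral_congr fun z => ?_
  rw [Pi.mul_apply, mul_comm, gaussianPDF, ← ENNReal.ofReal_mul (h0 z)]

lemma integrable_sq_of_lipschitz {D : ℝ → ℝ} (hD : LipschitzWith 1 D) :
    Integrable (fun z => D z ^ 2) (gaussianReal 0 1) := by
  have hc := hD.continuous
  refine Integrable.mono' (g := fun z => 2 * D 0 ^ 2 + 2 * z ^ 2)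
    ((integrable_const _).add (integrable_sq_gaussianReal.const_mul _)) (by fun_prop)
    (Filter.Eventually.of_forall fun z => ?_)
  have h := hD.dist_le_mul z 0
  simp only [Real.dist_eq, NNReal.coe_one, one_mul, sub_zero] at h
  have h2 := sq_le_sq' (by linarith [abs_nonneg (D z - D 0), abs_nonneg z]) h
  rw [sq_abs, sq_abs] at h2
  rw [Real.norm_of_nonneg (sq_nonneg _)]
  nlinarith [sq_nonneg (D z - 2 * D 0)]

/-- The constant relating the exponential moments of a Lipschitz function to its second moment,
when the latter is at most `M`. -/
noncomputable def momentConst (M : ℝ) : ℝ := Real.exp (M + 1) + 16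

lemma momentConst_pos (M : ℝ) : 0 < momentConst M := by unfold momentConst; positivity

/-- A nonnegative `1`-Lipschitz function of a Gaussian variable has an exponential second moment
that is linear in its second moment. -/
lemma integrable_and_integral_sq_mul_exp_le {D : ℝ → ℝ} (hD : LipschitzWith 1 D)
    (h0 : ∀ z, 0 ≤ D z) {M : ℝ} (hM : ∫ z, D z ^ 2 ∂(gaussianReal 0 1) ≤ M) :
    Integrable (fun z => D z ^ 2 * Real.exp (D z ^ 2 / 8)) (gaussianReal 0 1) ∧
    ∫ z, D z ^ 2 * Real.exp (D z ^ 2 / 8) ∂(gaussianReal 0 1)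
      ≤ momentConst M * ∫ z, D z ^ 2 ∂(gaussianReal 0 1) := by
  have hc := hD.continuous
  have hmD : Measurable D := hc.measurable
  have hint := integrable_sq_of_lipschitz hD
  have hM0 : D 0 ^ 2 ≤ 2 * M + 2 := by
    have h1 : ∫ _z : ℝ, D 0 ^ 2 ∂(gaussianReal 0 1)
        ≤ ∫ z, (2 * D z ^ 2 + 2 * z ^ 2) ∂(gaussianReal 0 1) := by
      refine integral_mono (integrable_const _)
        ((hint.const_mul _).add (integrable_sq_gaussianReal.const_mul _)) fun z => ?_
      have h := hD.dist_le_mul 0 z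
      simp only [Real.dist_eq, NNReal.coe_one, one_mul, zero_sub, abs_neg] at h
      have h2 := sq_le_sq' (by linarith [abs_nonneg (D 0 - D z), abs_nonneg z]) h
      rw [sq_abs, sq_abs] at h2
      simp only
      nlinarith [sq_nonneg (D 0 - 2 * D z)]
    rw [integral_add (hint.const_mul _) (integrable_sq_gaussianReal.const_mul _),
      integral_const_mul, integral_const_mul, integral_sq_gaussianReal] at h1
    simp at h1
    linarith
  have hmain : ∫⁻ z, ENNReal.ofReal (D z ^ 2 * Real.exp (D z ^ 2 / 8)) ∂(gaussianReal 0 1)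
      ≤ ENNReal.ofReal (momentConst M) * ∫⁻ z, ENNReal.ofReal (D z ^ 2) ∂(gaussianReal 0 1) := by
    rw [lintegral_gaussianReal (by fun_prop) (fun z => by positivity),
      lintegral_gaussianReal (by fun_prop) (fun z => by positivity)]
    have hpm := measurable_gaussianPDFReal 0 1
    set f : ℝ → ℝ≥0∞ := fun z => ENNReal.ofReal (D z ^ 2 * gaussianPDFReal 0 1 z) with hf
    have hfm : Measurable f := by fun_prop
    have hn : ∀ w, 0 ≤ D w ^ 2 * gaussianPDFReal 0 1 w := fun w =>
      mul_nonneg (sq_nonneg _) (gaussianPDFReal_nonneg _ _ _)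
    have e4 : ENNReal.ofReal 4 = 4 := by simp
    calc ∫⁻ z, ENNReal.ofReal (D z ^ 2 * Real.exp (D z ^ 2 / 8) * gaussianPDFReal 0 1 z)
        ≤ ∫⁻ z, (ENNReal.ofReal (Real.exp (M + 1)) * f z
            + 4 * f (z + (-1 / 2) * D z) + 4 * f (z + 1 / 2 * D z)) := by
          refine lintegral_mono fun z => ?_
          refine (ENNReal.ofReal_le_ofReal (sq_mul_exp_mul_pdf_le hD h0 hM0 z)).trans ?_
          have hn1 := hn (z + (-1 / 2) * D z)
          have hn2 := hn (z + 1 / 2 * D z)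
          have hn0 := hn z
          rw [ENNReal.ofReal_add (by positivity) (by positivity),
            ENNReal.ofReal_add (by positivity) (by positivity),
            ENNReal.ofReal_mul (Real.exp_pos _).le,
            ENNReal.ofReal_mul (p := 4) (q := D (z + (-1 / 2) * D z) ^ 2 * _) (by norm_num),
            ENNReal.ofReal_mul (p := 4) (q := D (z + 1 / 2 * D z) ^ 2 * _) (by norm_num), e4]
      _ = ENNReal.ofReal (Real.exp (M + 1)) * (∫⁻ z, f z)
            + 4 * (∫⁻ z, f (z + (-1 / 2) * D z)) + 4 * ∫⁻ z, f (z + 1 / 2 * D z) := by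
          rw [lintegral_add_right _ (by fun_prop), lintegral_add_right _ (by fun_prop),
            lintegral_const_mul _ hfm, lintegral_const_mul _ (by fun_prop),
            lintegral_const_mul _ (by fun_prop)]
      _ ≤ ENNReal.ofReal (Real.exp (M + 1)) * (∫⁻ z, f z)
            + 4 * (2 * ∫⁻ z, f z) + 4 * (2 * ∫⁻ z, f z) := by
          have a1 := (antilipschitz_add_half hD (s := -1 / 2)
            (by norm_num)).lintegral_comp_le (by fun_prop) hfm
          have a2 := (antilipschitz_add_half hD (s := 1 / 2)
            (by norm_num)).lintegral_comp_le (by fun_prop) hfm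
          simp only [ENNReal.coe_ofNat] at a1 a2
          gcongr
      _ = ENNReal.ofReal (momentConst M) * ∫⁻ z, f z := by
          rw [momentConst, ENNReal.ofReal_add (Real.exp_pos _).le (by norm_num)]
          simp only [ENNReal.ofReal_ofNat]
          ring
  have hfin : ∫⁻ z, ENNReal.ofReal (D z ^ 2) ∂(gaussianReal 0 1)
      = ENNReal.ofReal (∫ z, D z ^ 2 ∂(gaussianReal 0 1)) :=
    (ofReal_integral_eq_lintegral_ofReal hint
      (Filter.Eventually.of_forall fun z => sq_nonneg _)).symm
  rw [hfin, ← ENNReal.ofReal_mul (momentConst_pos M).le] at hmain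
  have hI : Integrable (fun z => D z ^ 2 * Real.exp (D z ^ 2 / 8)) (gaussianReal 0 1) := by
    refine ⟨by fun_prop, ?_⟩
    rw [hasFiniteIntegral_iff_ofReal (Filter.Eventually.of_forall fun z => by positivity)]
    exact hmain.trans_lt ENNReal.ofReal_lt_top
  refine ⟨hI, ?_⟩
  rw [← ofReal_integral_eq_lintegral_ofReal hI
    (Filter.Eventually.of_forall fun z => by positivity)] at hmain
  exact (ENNReal.ofReal_le_ofReal_iff (mul_nonneg (momentConst_pos M).le
    (integral_nonneg fun z => sq_nonneg _))).1 hmain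

lemma exp_mul_le_of_le {x l : ℝ} (hx : 0 ≤ x) (hl : 0 ≤ l) (hl' : l ≤ 1 / 16) :
    Real.exp (l * x) ≤ 1 + l * x + 16 * l ^ 2 * (x * Real.exp (x / 8)) := by
  have hlx : 0 ≤ l * x := by positivity
  -- equivalent to `1 - t ^ 2 ≤ (1 + t) * exp (-t)`, where `1 - t ≤ exp (-t)`
  have h1 : Real.exp (l * x) ≤ 1 + l * x + (l * x) ^ 2 * Real.exp (l * x) := by
    have h := Real.add_one_le_exp (-(l * x))
    have h' : (1 - l * x) * Real.exp (l * x) ≤ 1 := by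
      calc _ ≤ Real.exp (-(l * x)) * Real.exp (l * x) := by gcongr; linarith
        _ = 1 := by rw [← Real.exp_add]; simp
    nlinarith
  have h2 : x * Real.exp (l * x) ≤ 16 * Real.exp (x / 8) := by
    have h3 : x / 16 ≤ Real.exp (x / 16) := by linarith [Real.add_one_le_exp (x / 16)]
    have h4 : Real.exp (l * x) ≤ Real.exp (x / 16) := Real.exp_le_exp.2 (by nlinarith)
    calc x * Real.exp (l * x) ≤ (16 * Real.exp (x / 16)) * Real.exp (x / 16) := by
          gcongr; linarith
      _ = _ := by rw [mul_assoc, ← Real.exp_add]; ring_nf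
  have h5 : (l * x) ^ 2 * Real.exp (l * x) ≤ 16 * l ^ 2 * (x * Real.exp (x / 8)) := by
    calc _ = l ^ 2 * x * (x * Real.exp (l * x)) := by ring
      _ ≤ l ^ 2 * x * (16 * Real.exp (x / 8)) := by gcongr
      _ = _ := by ring
  linarith

/-- Moment generating function of the square of a Lipschitz function of a Gaussian variable. -/
lemma integrable_and_integral_exp_mul_sq_le {D : ℝ → ℝ} (hD : LipschitzWith 1 D)
    (h0 : ∀ z, 0 ≤ D z) {M : ℝ} (hM : ∫ z, D z ^ 2 ∂(gaussianReal 0 1) ≤ M) {l : ℝ}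
    (hl : 0 ≤ l) (hl' : l ≤ 1 / 16) :
    Integrable (fun z => Real.exp (l * D z ^ 2)) (gaussianReal 0 1) ∧
    ∫ z, Real.exp (l * D z ^ 2) ∂(gaussianReal 0 1) ≤
      Real.exp (l * (1 + 16 * momentConst M * l) * ∫ z, D z ^ 2 ∂(gaussianReal 0 1)) := by
  have hc := hD.continuous
  obtain ⟨i1, i2⟩ := integrable_and_integral_sq_mul_exp_le hD h0 hM
  have i0 := integrable_sq_of_lipschitz hD
  have hb := fun z => exp_mul_le_of_le (sq_nonneg (D z)) hl hl'
  have iR : Integrable (fun z => 1 + l * D z ^ 2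
      + 16 * l ^ 2 * (D z ^ 2 * Real.exp (D z ^ 2 / 8))) (gaussianReal 0 1) :=
    ((integrable_const _).add (i0.const_mul _)).add (i1.const_mul _)
  have iL : Integrable (fun z => Real.exp (l * D z ^ 2)) (gaussianReal 0 1) :=
    iR.mono' (by fun_prop) (Filter.Eventually.of_forall fun z => by
      rw [Real.norm_of_nonneg (Real.exp_pos _).le]; exact hb z)
  refine ⟨iL, (integral_mono iL iR hb).trans ?_⟩
  rw [integral_add (f := fun z => 1 + l * D z ^ 2)
    ((integrable_const _).add (i0.const_mul _)) (i1.const_mul _),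
    integral_add (integrable_const _) (i0.const_mul _), integral_const_mul, integral_const_mul]
  simp only [integral_const, probReal_univ, smul_eq_mul, mul_one]
  refine le_trans ?_ (Real.add_one_le_exp _)
  nlinarith [mul_le_mul_of_nonneg_left i2 (by positivity : 0 ≤ 16 * l ^ 2)]

/-! ### Optimal scalar codebooks -/

/-- The distance from `z` to the centroid by which it is replaced. -/
def quantErr {K : ℕ} (a : Fin K → ℝ) (enc : ℝ → Fin K) (z : ℝ) : ℝ := |z - a (enc z)|

lemma quantErr_nonneg {K : ℕ} (a : Fin K → ℝ) (enc : ℝ → Fin K) (z : ℝ) :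
    0 ≤ quantErr a enc z := abs_nonneg _

lemma IsNearestCode.lipschitzWith {K : ℕ} {a : Fin K → ℝ} {enc : ℝ → Fin K}
    (h : IsNearestCode a enc) : LipschitzWith 1 (quantErr a enc) := by
  refine LipschitzWith.of_le_add fun x y => ?_
  have h1 := h.2 x (enc y)
  have h2 := abs_sub_le x y (a (enc y))
  rw [Real.dist_eq]
  unfold quantErr
  linarith

lemma IsNearestCode.iInf_eq {K : ℕ} {a : Fin K → ℝ} {enc : ℝ → Fin K}
    (h : IsNearestCode a enc) (z : ℝ) : ⨅ i, (z - a i) ^ 2 = quantErr a enc z ^ 2 := by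
  have : Nonempty (Fin K) := ⟨enc z⟩
  refine le_antisymm ?_ (le_ciInf fun i => ?_)
  · rw [quantErr, sq_abs]
    exact ciInf_le (Set.finite_range _).bddBelow (enc z)
  · rw [quantErr]
    exact sq_le_sq.2 (by rw [abs_abs]; exact h.2 z i)

lemma iInf_sub_sq_le {K : ℕ} (a : Fin K → ℝ) (z : ℝ) (i : Fin K) :
    ⨅ i, (z - a i) ^ 2 ≤ (z - a i) ^ 2 :=
  ciInf_le (Set.finite_range _).bddBelow i

lemma iInf_sub_sq_nonneg {K : ℕ} (a : Fin K → ℝ) (z : ℝ) : 0 ≤ ⨅ i, (z - a i) ^ 2 :=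
  Real.iInf_nonneg fun _ => sq_nonneg _

/-- The mean squared error of an optimal codebook is at most that of any other one. -/
lemma IsLloydMax.integral_quantErr_sq_le {μ : Measure ℝ} {K : ℕ} {a : Fin K → ℝ}
    {enc : ℝ → Fin K} (h : IsLloydMax μ a) (henc : IsNearestCode a enc) {f : ℝ → ℝ}
    (hf : Integrable f μ) (a' : Fin K → ℝ) (hle : ∀ z, ∃ i, (z - a' i) ^ 2 ≤ f z) :
    ∫ z, quantErr a enc z ^ 2 ∂μ ≤ ∫ z, f z ∂μ := by
  simp_rw [← henc.iInf_eq]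
  refine (h a').trans (integral_mono_of_nonneg
    (Filter.Eventually.of_forall fun z => iInf_sub_sq_nonneg a' z) hf
    (Filter.Eventually.of_forall fun z => ?_))
  obtain ⟨i, hi⟩ := hle z
  exact (iInf_sub_sq_le a' z i).trans hi

/-- The points `-log (i / n)`, `1 ≤ i ≤ n`, are `exp z / n`-dense at `z ≥ 0`. -/
lemma exists_log_grid {n : ℕ} (hn : 0 < n) {z : ℝ} (hz : 0 ≤ z) :
    ∃ i : Fin n, |z - -Real.log ((i + 1 : ℝ) / n)| ≤ Real.exp z / n := by
  have hn' : (0 : ℝ) < n := by exact_mod_cast hn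
  set t := Real.exp (-z) with ht
  have ht0 : 0 < t := Real.exp_pos _
  have ht1 : t ≤ 1 := Real.exp_le_one_iff.2 (by linarith)
  have hc0 : 0 < ⌈t * n⌉₊ := Nat.ceil_pos.2 (by positivity)
  have hcn : ⌈t * n⌉₊ ≤ n := Nat.ceil_le.2 (by nlinarith)
  refine ⟨⟨⌈t * n⌉₊ - 1, by omega⟩, ?_⟩
  have hcast : ((⌈t * n⌉₊ - 1 : ℕ) : ℝ) + 1 = (⌈t * n⌉₊ : ℝ) := by
    rw [Nat.cast_sub (by omega)]; simp
  simp only [hcast]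
  set c : ℝ := (⌈t * n⌉₊ : ℝ) with hc
  have h1 : t * n ≤ c := Nat.le_ceil _
  have h2 : c < t * n + 1 := Nat.ceil_lt_add_one (by positivity)
  have hcpos : 0 < c := by positivity
  have hzt : z = -Real.log t := by rw [ht, Real.log_exp, neg_neg]
  have e : z - -Real.log (c / n) = Real.log (c / n / t) := by
    rw [Real.log_div (by positivity) ht0.ne', hzt]; ring
  have hexp : Real.exp z = 1 / t := by rw [ht, Real.exp_neg]; simp
  rw [e, abs_of_nonneg (Real.log_nonneg ?_), hexp]
  · refine (Real.log_le_sub_one_of_pos (by positivity)).trans ?_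
    rw [div_div, div_div, div_sub_one (by positivity), mul_comm t]
    gcongr
    linarith
  · rw [div_div, le_div_iff₀ (by positivity)]
    linarith

/-- A codebook of `2 ^ b` levels whose resolution degrades only exponentially with `|z|`, slowly
enough for the Gaussian tails. -/
lemma exists_exponential_codebook (b : ℕ) :
    ∃ a : Fin (2 ^ b) → ℝ, ∀ z : ℝ, ∃ i, |z - a i| ≤ 2 * Real.exp |z| / 2 ^ b := by
  cases b with
  | zero =>
    refine ⟨fun _ => 0, fun z => ⟨0, ?_⟩⟩
    have := Real.add_one_le_exp |z|
    simp only [sub_zero, pow_zero, div_one]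
    linarith [abs_nonneg z]
  | succ b =>
    have e : 2 ^ (b + 1) = 2 ^ b + 2 ^ b := by ring
    have hn : 0 < 2 ^ b := by positivity
    refine ⟨fun i => if (i : ℕ) < 2 ^ b then -Real.log (((i : ℕ) + 1 : ℝ) / (2 ^ b : ℕ))
      else Real.log ((((i : ℕ) - 2 ^ b : ℕ) + 1 : ℝ) / (2 ^ b : ℕ)), fun z => ?_⟩
    have e2 : 2 * Real.exp |z| / 2 ^ (b + 1) = Real.exp |z| / (2 ^ b : ℕ) := by
      rw [pow_succ]; push_cast; field_simp
    rw [e2]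
    rcases le_total 0 z with hz | hz
    · obtain ⟨i, hi⟩ := exists_log_grid hn hz
      refine ⟨⟨i, by omega⟩, ?_⟩
      simpa [i.2, abs_of_nonneg hz] using hi
    · obtain ⟨i, hi⟩ := exists_log_grid hn (z := -z) (by linarith)
      refine ⟨⟨2 ^ b + i, by omega⟩, ?_⟩
      rw [abs_of_nonpos hz]
      have : ¬ (2 ^ b + (i : ℕ) < 2 ^ b) := by omega
      simp only [this, if_false, Nat.add_sub_cancel_left]
      rw [← abs_neg]
      convert hi using 2
      ring

lemma integrable_exp_two_mul_abs :
    Integrable (fun z => Real.exp (2 * |z|)) (gaussianReal 0 1) := by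
  refine Integrable.mono' ((integrable_exp_mul_gaussianReal 2).add
    (integrable_exp_mul_gaussianReal (-2))) (by fun_prop) (Filter.Eventually.of_forall fun z => ?_)
  rw [Real.norm_of_nonneg (Real.exp_pos _).le]
  rcases abs_cases z with ⟨h, _⟩ | ⟨h, _⟩ <;> rw [h] <;> simp only [Pi.add_apply]
  · linarith [Real.exp_pos (-2 * z)]
  · rw [mul_neg, ← neg_mul]; linarith [Real.exp_pos (2 * z)]

lemma integral_exp_two_mul_abs_le :
    ∫ z, Real.exp (2 * |z|) ∂(gaussianReal 0 1) ≤ 15 := by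
  have h : ∫ z, Real.exp (2 * |z|) ∂(gaussianReal 0 1)
      ≤ ∫ z, (Real.exp (2 * z) + Real.exp (-2 * z)) ∂(gaussianReal 0 1) := by
    refine integral_mono integrable_exp_two_mul_abs ((integrable_exp_mul_gaussianReal 2).add
      (integrable_exp_mul_gaussianReal (-2))) fun z => ?_
    rcases abs_cases z with ⟨h, _⟩ | ⟨h, _⟩ <;> simp only [h]
    · linarith [Real.exp_pos (-2 * z)]
    · rw [mul_neg, ← neg_mul]; linarith [Real.exp_pos (2 * z)]
  have m := fun t => congrFun (mgf_fun_id_gaussianReal (μ := 0) (v := 1)) t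
  simp only [mgf] at m
  rw [integral_add (integrable_exp_mul_gaussianReal 2) (integrable_exp_mul_gaussianReal (-2)),
    m, m] at h
  have e : Real.exp 2 ≤ 7.5 := by
    have := Real.exp_one_lt_d9
    have h2 : Real.exp 2 = Real.exp 1 ^ 2 := by rw [← Real.exp_nat_mul]; norm_num
    rw [h2]
    nlinarith [Real.exp_pos 1]
  norm_num at h
  linarith

lemma two_mul_exp_abs_div_sq (b : ℕ) (z : ℝ) :
    (2 * Real.exp |z| / 2 ^ b) ^ 2 = 4 / (2 ^ b) ^ 2 * Real.exp (2 * |z|) := by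
  rw [two_mul |z|, Real.exp_add]; ring

lemma integrable_quantErr_bound (b : ℕ) :
    Integrable (fun z => (2 * Real.exp |z| / 2 ^ b) ^ 2) (gaussianReal 0 1) := by
  simp_rw [two_mul_exp_abs_div_sq]
  exact integrable_exp_two_mul_abs.const_mul _

lemma integral_quantErr_bound_le (b : ℕ) :
    ∫ z, (2 * Real.exp |z| / 2 ^ b) ^ 2 ∂(gaussianReal 0 1) ≤ 60 / (2 ^ b) ^ 2 := by
  simp_rw [two_mul_exp_abs_div_sq]
  rw [integral_const_mul]
  calc _ ≤ 4 / (2 ^ b) ^ 2 * (15 : ℝ) := by gcongr; exact integral_exp_two_mul_abs_le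
    _ = _ := by ring

lemma IsLloydMax.gaussian_mse_le {b : ℕ} {q : Fin (2 ^ b) → ℝ} {enc : ℝ → Fin (2 ^ b)}
    (h : IsLloydMax (gaussianReal 0 1) q) (henc : IsNearestCode q enc) :
    ∫ z, quantErr q enc z ^ 2 ∂(gaussianReal 0 1) ≤ 60 / (2 ^ b) ^ 2 := by
  obtain ⟨a, ha⟩ := exists_exponential_codebook b
  refine (h.integral_quantErr_sq_le henc (integrable_quantErr_bound b) a fun z => ?_).trans
    (integral_quantErr_bound_le b)
  obtain ⟨i, hi⟩ := ha z
  exact ⟨i, sq_le_sq' (by linarith [abs_nonneg (z - a i), neg_abs_le (z - a i)])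
    ((le_abs_self _).trans hi)⟩

/-- Already the two centroids `±√(2/π)` reduce the mean squared error to `1 - 2/π`. -/
lemma IsLloydMax.gaussian_mse_le_one_sub {b : ℕ} (hb : 1 ≤ b) {q : Fin (2 ^ b) → ℝ}
    {enc : ℝ → Fin (2 ^ b)} (h : IsLloydMax (gaussianReal 0 1) q) (henc : IsNearestCode q enc) :
    ∫ z, quantErr q enc z ^ 2 ∂(gaussianReal 0 1) ≤ 1 - 2 / Real.pi := by
  have h2 : 2 ≤ 2 ^ b := by calc 2 = 2 ^ 1 := rfl
    _ ≤ 2 ^ b := Nat.pow_le_pow_right (by norm_num) hb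
  set s := √(2 / Real.pi)
  have hs : s ^ 2 = 2 / Real.pi := Real.sq_sqrt (by positivity)
  have i1 : Integrable (fun z => z ^ 2 - 2 * s * |z|) (gaussianReal 0 1) :=
    integrable_sq_gaussianReal.sub (integrable_abs_gaussianReal.const_mul _)
  refine (h.integral_quantErr_sq_le henc (f := fun z => z ^ 2 - 2 * s * |z| + s ^ 2)
    (i1.add (integrable_const _))
    (fun i => if (i : ℕ) = 0 then s else -s) fun z => ?_).trans (le_of_eq ?_)
  · rcases le_total 0 z with hz | hz
    · exact ⟨⟨0, by omega⟩, by simp only [abs_of_nonneg hz, if_true]; apply le_of_eq; ring⟩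
    · exact ⟨⟨1, by omega⟩, by
        simp only [abs_of_nonpos hz, one_ne_zero, if_false]; apply le_of_eq; ring⟩
  · rw [integral_add i1 (integrable_const _), integral_sub integrable_sq_gaussianReal
      (integrable_abs_gaussianReal.const_mul _), integral_const_mul, integral_sq_gaussianReal,
      integral_abs_gaussianReal]
    simp only [integral_const, probReal_univ, smul_eq_mul]
    linear_combination -hs

lemma IsNearestCode.scale {K : ℕ} {a q : Fin K → ℝ} {enc : ℝ → Fin K} (h : IsNearestCode a enc)
    {r : ℝ} (hr : 0 < r) (hq : ∀ i, a i = q i / r) :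
    IsNearestCode q fun z => enc (z / r) := by
  refine ⟨h.1.comp (by fun_prop), fun z j => ?_⟩
  have := h.2 (z / r) j
  rw [hq, hq, ← sub_div, ← sub_div, abs_div, abs_div] at this
  exact (div_le_div_iff_of_pos_right (abs_pos.2 hr.ne')).1 this

lemma quantErr_scale {K : ℕ} {a q : Fin K → ℝ} (enc : ℝ → Fin K) {r : ℝ} (hr : 0 < r)
    (hq : ∀ i, a i = q i / r) (z : ℝ) :
    quantErr q (fun z => enc (z / r)) (r * z) = r * quantErr a enc z := by
  simp only [quantErr]
  rw [mul_div_cancel_left₀ _ hr.ne', hq]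
  nth_rw 2 [← abs_of_pos hr]
  rw [← abs_mul]
  congr 1
  field_simp

/-! ### Gaussian vectors: Chernoff bounds, norms and directions -/

/-- Chernoff bound for a sum of independent identically distributed variables. -/
lemma chernoff_pi {ι Ω : Type*} [Fintype ι] [MeasurableSpace Ω] {μ : Measure Ω}
    [IsProbabilityMeasure μ] {f : Ω → ℝ}
    (hint : Integrable (fun w => Real.exp (f w)) μ) {A : ℝ}
    (hA : ∫ w, Real.exp (f w) ∂μ ≤ Real.exp A) (T : ℝ) :
    (Measure.pi fun _ : ι => μ).real {w | T ≤ ∑ i, f (w i)}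
      ≤ Real.exp (Fintype.card ι * A - T) := by
  have hI : Integrable (fun w : ι → Ω => Real.exp (∑ i, f (w i))) (Measure.pi fun _ => μ) := by
    simp_rw [Real.exp_sum]
    exact Integrable.fintype_prod (f := fun _ w => Real.exp (f w)) fun _ => hint
  have h := mul_meas_ge_le_integral_of_nonneg (μ := Measure.pi fun _ : ι => μ)
    (f := fun w => Real.exp (∑ i, f (w i)))
    (Filter.Eventually.of_forall fun w => (Real.exp_pos _).le) hI (Real.exp T)
  simp only [Real.exp_le_exp] at h
  have h2 : ∫ w, Real.exp (∑ i, f (w i)) ∂(Measure.pi fun _ : ι => μ)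
      ≤ Real.exp (Fintype.card ι * A) := by
    simp_rw [Real.exp_sum]
    rw [integral_fintype_prod_eq_prod (f := fun _ w => Real.exp (f w)), Finset.prod_const,
      Finset.card_univ, Real.exp_nat_mul]
    exact pow_le_pow_left₀ (integral_nonneg fun w => (Real.exp_pos _).le) hA _
  rw [Real.exp_sub, le_div_iff₀ (Real.exp_pos _), mul_comm]
  exact h.trans h2

/-- The standard Gaussian measure on `ℝ^d`. -/
noncomputable abbrev stdG (d : ℕ) : Measure (EuclideanSpace ℝ (Fin d)) :=
  stdGaussian (EuclideanSpace ℝ (Fin d))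

lemma chernoff_stdG {f : ℝ → ℝ} (hf : Measurable f)
    (hint : Integrable (fun w => Real.exp (f w)) (gaussianReal 0 1)) {A : ℝ}
    (hA : ∫ w, Real.exp (f w) ∂(gaussianReal 0 1) ≤ Real.exp A) (T : ℝ) :
    (stdG d).real {g | T ≤ ∑ i, f (g i)} ≤ Real.exp (d * A - T) := by
  rw [stdG, ← map_pi_eq_stdGaussian, map_measureReal_apply (by fun_prop)
    (measurableSet_le measurable_const (by fun_prop))]
  simpa using chernoff_pi (ι := Fin d) hint hA T

/-- `D` applied to every coordinate. -/
noncomputable def coordMap (D : ℝ → ℝ) (v : EuclideanSpace ℝ (Fin d)) :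
    EuclideanSpace ℝ (Fin d) := WithLp.toLp 2 fun i => D (v i)

lemma norm_coordMap_sq (D : ℝ → ℝ) (v : EuclideanSpace ℝ (Fin d)) :
    ‖coordMap D v‖ ^ 2 = ∑ i, D (v i) ^ 2 := by
  rw [EuclideanSpace.real_norm_sq_eq]; rfl

lemma norm_coordMap_le {D : ℝ → ℝ} (hD : LipschitzWith 1 D) (v w : EuclideanSpace ℝ (Fin d)) :
    ‖coordMap D v‖ ≤ ‖coordMap D w‖ + ‖v - w‖ := by
  have h : ‖coordMap D v - coordMap D w‖ ≤ ‖v - w‖ := by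
    refine (sq_le_sq₀ (norm_nonneg _) (norm_nonneg _)).1 ?_
    rw [EuclideanSpace.real_norm_sq_eq, EuclideanSpace.real_norm_sq_eq]
    refine Finset.sum_le_sum fun i _ => ?_
    have := hD.dist_le_mul (v i) (w i)
    simp only [Real.dist_eq, NNReal.coe_one, one_mul] at this
    exact sq_le_sq.2 this
  have := norm_sub_norm_le (coordMap D v) (coordMap D w)
  linarith

/-- The direction of a vector (zero for the zero vector). -/
noncomputable def direction {E : Type*} [NormedAddCommGroup E] [NormedSpace ℝ E] (g : E) : E :=
  ‖g‖⁻¹ • g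

lemma norm_direction {E : Type*} [NormedAddCommGroup E] [NormedSpace ℝ E] {g : E} (hg : g ≠ 0) :
    ‖direction g‖ = 1 := by
  rw [direction, norm_smul, norm_inv, norm_norm, inv_mul_cancel₀ (norm_ne_zero_iff.2 hg)]

lemma norm_smul_direction_sub_le {E : Type*} [NormedAddCommGroup E] [NormedSpace ℝ E]
    (r : ℝ) (g : E) : ‖r • direction g - g‖ ≤ |r - ‖g‖| := by
  by_cases hg : g = 0
  · simp [hg, direction]
  · have hn : ‖g‖ ≠ 0 := norm_ne_zero_iff.2 hg
    have : r • direction g - g = (r - ‖g‖) • direction g := by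
      rw [sub_smul]
      congr 1
      rw [direction, smul_smul, mul_inv_cancel₀ hn, one_smul]
    rw [this, norm_smul, norm_direction hg, mul_one, Real.norm_eq_abs]

lemma measurable_direction : Measurable (direction : EuclideanSpace ℝ (Fin d) → _) := by
  unfold direction
  fun_prop

lemma stdG_sum_sq_tail {D : ℝ → ℝ} (hD : LipschitzWith 1 D) (h0 : ∀ z, 0 ≤ D z) {M : ℝ}
    (hM : ∫ z, D z ^ 2 ∂(gaussianReal 0 1) ≤ M) {l : ℝ} (hl : 0 < l) (hl' : l ≤ 1 / 16) (s : ℝ) :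
    (stdG d).real {g | (1 + 16 * momentConst M * l) * (d * ∫ z, D z ^ 2 ∂(gaussianReal 0 1)) + s / l
      ≤ ‖coordMap D g‖ ^ 2} ≤ Real.exp (-s) := by
  have hc := hD.continuous
  obtain ⟨i1, i2⟩ := integrable_and_integral_exp_mul_sq_le hD h0 hM hl.le hl'
  set m := ∫ z, D z ^ 2 ∂(gaussianReal 0 1)
  have h := chernoff_stdG (d := d) (f := fun z => l * D z ^ 2) (by fun_prop) i1 i2
    (l * ((1 + 16 * momentConst M * l) * (d * m) + s / l))
  convert h using 2
  · ext g
    simp only [Set.mem_ofPred_eq, ← Finset.mul_sum, ← norm_coordMap_sq]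
    exact (mul_le_mul_iff_right₀ hl).symm
  · field_simp
    ring

lemma stdG_norm_sq_tail {t : ℝ} (ht : 0 < t) (ht1 : t ≤ 1) :
    (stdG d).real {g | t * d ≤ |‖g‖ ^ 2 - d|} ≤ 2 * Real.exp (-(d * t ^ 2 / 8)) := by
  have key : ∀ l : ℝ, |l| = t / 4 →
      (stdG d).real {g | |l| * t * d ≤ l * (‖g‖ ^ 2 - d)} ≤ Real.exp (-(d * t ^ 2 / 8)) := by
    intro l hl
    have hl4 : |l| ≤ 1 / 4 := by linarith
    have h := chernoff_stdG (d := d) (f := fun z => l * (z ^ 2 - 1)) (by fun_prop)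
      (integrable_exp_mul_sq_sub_one hl4)
      (integral_exp_mul_sq_sub_one_le hl4) (|l| * t * d)
    convert h using 2
    · ext g
      simp only [Set.mem_ofPred_eq, ← Finset.mul_sum, Finset.sum_sub_distrib,
        EuclideanSpace.real_norm_sq_eq, Finset.sum_const, Finset.card_univ, Fintype.card_fin,
        nsmul_eq_mul, mul_one]
    · rw [← sq_abs l, hl]; ring
  have h1 := key (t / 4) (abs_of_nonneg (by positivity))
  have h2 := key (-(t / 4)) (by rw [abs_neg]; exact abs_of_nonneg (by positivity))
  have hsub : {g : EuclideanSpace ℝ (Fin d) | t * d ≤ |‖g‖ ^ 2 - d|} ⊆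
      {g | |t / 4| * t * d ≤ t / 4 * (‖g‖ ^ 2 - d)} ∪
      {g | |-(t / 4)| * t * d ≤ -(t / 4) * (‖g‖ ^ 2 - d)} := by
    intro g hg
    simp only [Set.mem_ofPred_eq, Set.mem_union] at hg ⊢
    rw [abs_neg, abs_of_nonneg (by positivity : 0 ≤ t / 4)]
    rcases le_abs.1 hg with h | h
    · left; nlinarith
    · right; nlinarith
  calc _ ≤ _ := measureReal_mono hsub
    _ ≤ _ := measureReal_union_le _ _
    _ ≤ _ := by linarith

/-- From the concentration of the squared norm to that of the norm. -/
lemma abs_sqrt_sub_le {n r : ℝ} (hn : 0 < n) (hr : 0 ≤ r) :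
    √n * |√n - r| ≤ |r ^ 2 - n| := by
  have h1 : r ^ 2 - n = -((√n - r) * (√n + r)) := by
    linear_combination Real.sq_sqrt hn.le
  have hs := Real.sqrt_nonneg n
  rw [h1, abs_neg, abs_mul, abs_of_nonneg (by positivity : 0 ≤ √n + r), mul_comm]
  gcongr
  linarith

lemma stdG_norm_tail {s : ℝ} (hs : 0 < s) (hsd : 8 * s ≤ d) :
    (stdG d).real {g | √(8 * s) < |√d - ‖g‖|} ≤ 2 * Real.exp (-s) := by
  have hd : (0 : ℝ) < d := by linarith
  have ht0 : 0 < √(8 * s / d) := Real.sqrt_pos.2 (by positivity)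
  have ht1 : √(8 * s / d) ≤ 1 := Real.sqrt_le_one.2 ((div_le_one hd).2 hsd)
  have h := stdG_norm_sq_tail (d := d) ht0 ht1
  rw [Real.sq_sqrt (by positivity), show (d : ℝ) * (8 * s / d) / 8 = s by field_simp] at h
  refine (measureReal_mono fun g hg => ?_).trans h
  simp only [Set.mem_ofPred_eq] at hg ⊢
  refine le_trans ?_ (abs_sqrt_sub_le hd (norm_nonneg g))
  have : √(8 * s / d) * d = √d * √(8 * s) := by
    rw [Real.sqrt_div (by positivity)]
    have := Real.sq_sqrt hd.le
    have h3 : √(d : ℝ) ≠ 0 := (Real.sqrt_pos.2 hd).ne'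
    field_simp
    exact this.symm
  rw [this]
  gcongr

/-- The residual of quantizing the coordinates of a point on the sphere of radius `√d`, for the
direction of a Gaussian vector. -/
lemma stdG_coordMap_direction_tail {D : ℝ → ℝ} (hD : LipschitzWith 1 D) (h0 : ∀ z, 0 ≤ D z)
    {M : ℝ} (hM : ∫ z, D z ^ 2 ∂(gaussianReal 0 1) ≤ M) {l : ℝ} (hl : 0 < l) (hl' : l ≤ 1 / 16)
    {s : ℝ} (hs : 0 < s) (hsd : 8 * s ≤ d) :
    (stdG d).real {g |
      √((1 + 16 * momentConst M * l) * (d * ∫ z, D z ^ 2 ∂(gaussianReal 0 1)) + s / l) + √(8 * s)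
      < ‖coordMap D (√d • direction g)‖} ≤ 3 * Real.exp (-s) := by
  set B := (1 + 16 * momentConst M * l) * (d * ∫ z, D z ^ 2 ∂(gaussianReal 0 1)) + s / l
  have hsub : {g : EuclideanSpace ℝ (Fin d) | √B + √(8 * s) < ‖coordMap D (√d • direction g)‖} ⊆
      {g | B ≤ ‖coordMap D g‖ ^ 2} ∪ {g | √(8 * s) < |√d - ‖g‖|} := by
    intro g hg
    simp only [Set.mem_ofPred_eq, Set.mem_union] at hg ⊢
    by_contra! hcon
    have h1 := norm_coordMap_le hD (√d • direction g) g
    have h2 := norm_smul_direction_sub_le (√d) g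
    have h3 : ‖coordMap D g‖ ≤ √B := Real.le_sqrt_of_sq_le hcon.1.le
    linarith
  calc _ ≤ _ := measureReal_mono hsub
    _ ≤ _ := measureReal_union_le _ _
    _ ≤ _ := add_le_add (stdG_sum_sq_tail hD h0 hM hl hl' s) (stdG_norm_tail hs hsd)
    _ = _ := by ring

/-! ### Gaussian vectors: linear functionals and orthogonal directions -/

lemma map_inner_stdG {v : EuclideanSpace ℝ (Fin d)} (hv : ‖v‖ = 1) :
    (stdG d).map (fun g => inner ℝ v g) = gaussianReal 0 1 := by
  have h := IsGaussian.map_eq_gaussianReal (μ := stdG d) (innerSL ℝ v)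
  rw [variance_dual_stdGaussian, integral_strongDual_stdGaussian, innerSL_apply_norm, hv] at h
  simpa using h

lemma gaussianReal_tail (s : ℝ) :
    (gaussianReal 0 1).real {z | √(4 * s) < |z|} ≤ 2 * Real.exp (-s) := by
  have h := mul_meas_ge_le_integral_of_nonneg (μ := gaussianReal 0 1)
    (f := fun z => Real.exp (1 / 4 * z ^ 2))
    (Filter.Eventually.of_forall fun w => (Real.exp_pos _).le)
    (integrable_exp_mul_sq (by norm_num)) (Real.exp s)
  rw [integral_exp_mul_sq (by norm_num)] at h
  have h2 : (√(1 - 2 * (1 / 4)))⁻¹ ≤ (2 : ℝ) := by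
    rw [inv_le_comm₀ (by positivity) (by norm_num)]
    exact Real.le_sqrt_of_sq_le (by norm_num)
  have h3 : (gaussianReal 0 1).real {z | √(4 * s) < |z|}
      ≤ (gaussianReal 0 1).real {z | Real.exp s ≤ Real.exp (1 / 4 * z ^ 2)} := by
    refine measureReal_mono fun z hz => ?_
    simp only [Set.mem_ofPred_eq, Real.exp_le_exp] at hz ⊢
    have := (Real.sqrt_lt' (lt_of_le_of_lt (Real.sqrt_nonneg _) hz)).1 hz
    rw [sq_abs] at this
    linarith
  rw [Real.exp_neg, ← div_eq_mul_inv, le_div_iff₀ (Real.exp_pos _), mul_comm]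
  exact (mul_le_mul_of_nonneg_left h3 (Real.exp_pos _).le).trans (h.trans h2)

lemma stdG_inner_tail (v : EuclideanSpace ℝ (Fin d)) (s : ℝ) :
    (stdG d).real {g | √(4 * s) * ‖v‖ < |inner ℝ v g|} ≤ 2 * Real.exp (-s) := by
  by_cases hv : v = 0
  · simp only [hv, norm_zero, mul_zero, inner_zero_left, abs_zero, lt_self_iff_false,
      Set.ofPred_false, measureReal_empty]
    positivity
  have hn : 0 < ‖v‖ := norm_pos_iff.2 hv
  have h := gaussianReal_tail s
  rw [← map_inner_stdG (norm_direction hv), map_measureReal_apply (by fun_prop)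
    (measurableSet_lt measurable_const (by fun_prop))] at h
  refine (measureReal_mono fun g hg => ?_).trans h
  simp only [Set.mem_ofPred_eq, Set.mem_preimage] at hg ⊢
  rw [direction, real_inner_smul_left, abs_mul, abs_inv, abs_norm, inv_mul_eq_div, lt_div_iff₀ hn]
  exact hg

lemma stdG_ae_inner_ne_zero {v : EuclideanSpace ℝ (Fin d)} (hv : v ≠ 0) :
    ∀ᵐ g ∂(stdG d), inner ℝ v g ≠ 0 := by
  have h : ∀ᵐ z ∂(gaussianReal 0 1), z ≠ 0 := by
    have := nullSingletonClass_gaussianReal (μ := 0) (v := 1) one_ne_zero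
    rw [ae_iff]; simp
  rw [← map_inner_stdG (norm_direction hv)] at h
  filter_upwards [ae_of_ae_map (by fun_prop) h] with g hg h0
  exact hg (by rw [direction, real_inner_smul_left, h0, mul_zero])

/-- The component of `h` orthogonal to the unit vector `x`. -/
noncomputable def orthPart (x h : EuclideanSpace ℝ (Fin d)) : EuclideanSpace ℝ (Fin d) :=
  h - (inner ℝ x h) • x

lemma inner_orthPart_comm (x a h : EuclideanSpace ℝ (Fin d)) :
    inner ℝ a (orthPart x h) = inner ℝ (orthPart x a) h := by
  simp only [orthPart, inner_sub_left, inner_sub_right, real_inner_smul_left,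
    real_inner_smul_right, real_inner_comm a x]
  ring

lemma inner_orthPart {x : EuclideanSpace ℝ (Fin d)} (hx : ‖x‖ = 1)
    (h : EuclideanSpace ℝ (Fin d)) : inner ℝ x (orthPart x h) = 0 := by
  simp [orthPart, inner_sub_right, real_inner_smul_right, hx]

lemma norm_orthPart_sq {x : EuclideanSpace ℝ (Fin d)} (hx : ‖x‖ = 1)
    (h : EuclideanSpace ℝ (Fin d)) : ‖orthPart x h‖ ^ 2 = ‖h‖ ^ 2 - inner ℝ x h ^ 2 := by
  rw [orthPart, @norm_sub_sq_real, norm_smul, hx, real_inner_smul_right, real_inner_comm x h,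
    Real.norm_eq_abs, mul_one, sq_abs]
  ring

lemma norm_orthPart_le {x : EuclideanSpace ℝ (Fin d)} (hx : ‖x‖ = 1)
    (h : EuclideanSpace ℝ (Fin d)) : ‖orthPart x h‖ ≤ ‖h‖ := by
  refine (sq_le_sq₀ (norm_nonneg _) (norm_nonneg _)).1 ?_
  rw [norm_orthPart_sq hx]
  linarith [sq_nonneg (inner ℝ x h : ℝ)]

/-- The projection of a fixed vector onto a uniformly random direction orthogonal to `x`. -/
lemma stdG_inner_direction_orthPart_tail {x : EuclideanSpace ℝ (Fin d)} (hx : ‖x‖ = 1)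
    (a : EuclideanSpace ℝ (Fin d)) {s : ℝ} (hs : 0 < s) (hsd : 32 * s ≤ d) :
    (stdG d).real {h | 8 * √(s / d) * ‖a‖ < |inner ℝ a (direction (orthPart x h))|}
      ≤ 6 * Real.exp (-s) := by
  have hd : (0 : ℝ) < d := by linarith
  -- a Gaussian vector is long and nearly orthogonal to `x`, so `‖orthPart x h‖ ≥ √d / 4`
  have h1 := stdG_inner_tail (orthPart x a) s
  have h2 := stdG_inner_tail x s
  have h3 := stdG_norm_tail (d := d) hs (by linarith)
  have hsub : {h : EuclideanSpace ℝ (Fin d) |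
        8 * √(s / d) * ‖a‖ < |inner ℝ a (direction (orthPart x h))|} ⊆
      ({g | √(4 * s) * ‖orthPart x a‖ < |inner ℝ (orthPart x a) g|} ∪
        {g | √(4 * s) * ‖x‖ < |inner ℝ x g|}) ∪ {g | √(8 * s) < |√d - ‖g‖|} := by
    intro h hh
    simp only [Set.mem_ofPred_eq, Set.mem_union] at hh ⊢
    by_contra! hcon
    obtain ⟨⟨c1, c2⟩, c3⟩ := hcon
    rw [hx, mul_one] at c2
    have sd := Real.sq_sqrt hd.le
    have sd0 := Real.sqrt_pos.2 hd
    have e8 : √(8 * s) ≤ √d / 2 := by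
      rw [Real.sqrt_le_left (by positivity), div_pow, sd]; linarith
    have hnh : √d / 2 ≤ ‖h‖ := by linarith [(abs_le.1 c3).2]
    have c2' : inner ℝ x h ^ 2 ≤ 4 * s := by
      rw [← sq_abs, ← Real.sq_sqrt (by positivity : 0 ≤ 4 * s)]
      gcongr
    have hP : √d / 4 ≤ ‖orthPart x h‖ := by
      refine (sq_le_sq₀ (by positivity) (norm_nonneg _)).1 ?_
      rw [norm_orthPart_sq hx]
      have : (√d / 2) ^ 2 ≤ ‖h‖ ^ 2 := by gcongr
      rw [div_pow, sd] at this ⊢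
      linarith
    have hPa := norm_orthPart_le hx a
    have hPpos : 0 < ‖orthPart x h‖ := by linarith
    rw [direction, real_inner_smul_right, inner_orthPart_comm, abs_mul, abs_inv, abs_norm,
      inv_mul_eq_div, lt_div_iff₀ hPpos] at hh
    have e4 : √(4 * s) = 2 * √s := by
      rw [Real.sqrt_mul (by norm_num), show (4 : ℝ) = 2 ^ 2 by norm_num,
        Real.sqrt_sq (by norm_num)]
    rw [e4] at c1
    have e5 : √(s / d) = √s / √d := Real.sqrt_div hs.le _
    rw [e5] at hh
    have : 8 * (√s / √d) * ‖a‖ * (√d / 4) ≤ 8 * (√s / √d) * ‖a‖ * ‖orthPart x h‖ := by gcongr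
    have e6 : 8 * (√s / √d) * ‖a‖ * (√d / 4) = 2 * √s * ‖a‖ := by field_simp; ring
    have : 2 * √s * ‖orthPart x a‖ ≤ 2 * √s * ‖a‖ := by gcongr
    linarith
  calc _ ≤ _ := measureReal_mono hsub
    _ ≤ _ := measureReal_union_le _ _
    _ ≤ _ := add_le_add (measureReal_union_le _ _) le_rfl
    _ ≤ _ := by linarith

/-! ### Haar measure on the orthogonal group -/

instance : IsProbabilityMeasure (haarO d) := by
  refine ⟨?_⟩
  have := Measure.haarMeasure_self (K₀ := (⊤ : TopologicalSpace.PositiveCompacts (OrthGroup d)))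
  simpa [haarO] using this

instance : (haarO d).IsHaarMeasure := by unfold haarO; infer_instance

/-- The orthogonal group is compact, hence unimodular. -/
instance : (haarO d).IsMulRightInvariant := by
  refine ⟨fun Q => ?_⟩
  have : IsProbabilityMeasure (Measure.map (· * Q) (haarO d)) :=
    Measure.isProbabilityMeasure_map (continuous_mul_const Q).measurable.aemeasurable
  exact Measure.isHaarMeasure_eq_of_isProbabilityMeasure _ _

lemma rot_mul (R Q : OrthGroup d) (v : EuclideanSpace ℝ (Fin d)) :
    rot (R * Q) v = rot R (rot Q v) := by
  simp [rot, Matrix.toLpLin_mul_same]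

lemma rot_apply (R : OrthGroup d) (v : EuclideanSpace ℝ (Fin d)) (i : Fin d) :
    rot R v i = ∑ j, (R : Matrix (Fin d) (Fin d) ℝ) i j * v j := by
  simp [rot, Matrix.toLpLin_apply, Matrix.mulVec, dotProduct]

lemma rotInv_eq_rot_inv (R : OrthGroup d) (v : EuclideanSpace ℝ (Fin d)) :
    rotInv R v = rot R⁻¹ v := by
  have : ((R⁻¹ : OrthGroup d) : Matrix (Fin d) (Fin d) ℝ)
      = (R : Matrix (Fin d) (Fin d) ℝ).transpose := by
    rw [← Matrix.conjTranspose_eq_transpose_of_trivial]; rfl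
  rw [rotInv, rot, this]

lemma rot_one (v : EuclideanSpace ℝ (Fin d)) : rot 1 v = v := by
  simp [rot]

lemma rotInv_rot (R : OrthGroup d) (v : EuclideanSpace ℝ (Fin d)) : rotInv R (rot R v) = v := by
  rw [rotInv_eq_rot_inv, ← rot_mul, inv_mul_cancel, rot_one]

lemma rot_rotInv (R : OrthGroup d) (v : EuclideanSpace ℝ (Fin d)) : rot R (rotInv R v) = v := by
  rw [rotInv_eq_rot_inv, ← rot_mul, mul_inv_cancel, rot_one]

lemma inner_rotInv (R : OrthGroup d) (v z : EuclideanSpace ℝ (Fin d)) :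
    inner ℝ v (rotInv R z) = inner ℝ (rot R v) z := by
  rw [rotInv, ← Matrix.conjTranspose_eq_transpose_of_trivial,
    Matrix.toEuclideanLin_conjTranspose_eq_adjoint, LinearMap.adjoint_inner_right]
  rfl

lemma inner_rot_rot (R : OrthGroup d) (v w : EuclideanSpace ℝ (Fin d)) :
    inner ℝ (rot R v) (rot R w) = inner ℝ v w := by
  rw [← inner_rotInv, rotInv_rot]

lemma norm_rot (R : OrthGroup d) (v : EuclideanSpace ℝ (Fin d)) : ‖rot R v‖ = ‖v‖ := by
  rw [norm_eq_sqrt_real_inner, inner_rot_rot, ← norm_eq_sqrt_real_inner]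

lemma norm_rotInv (R : OrthGroup d) (v : EuclideanSpace ℝ (Fin d)) : ‖rotInv R v‖ = ‖v‖ := by
  rw [← norm_rot R, rot_rotInv]

/-- A rotation as a linear isometry equivalence. -/
noncomputable def rotIso (R : OrthGroup d) :
    EuclideanSpace ℝ (Fin d) ≃ₗᵢ[ℝ] EuclideanSpace ℝ (Fin d) where
  toFun := rot R
  invFun := rotInv R
  map_add' := map_add _
  map_smul' := map_smul _
  left_inv := rotInv_rot R
  right_inv := rot_rotInv R
  norm_map' := norm_rot R

lemma rotIso_apply (R : OrthGroup d) (v : EuclideanSpace ℝ (Fin d)) : rotIso R v = rot R v := rfl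

lemma rot_smul (R : OrthGroup d) (c : ℝ) (v : EuclideanSpace ℝ (Fin d)) :
    rot R (c • v) = c • rot R v := (rotIso R).map_smul c v

lemma rot_direction (R : OrthGroup d) (v : EuclideanSpace ℝ (Fin d)) :
    rot R (direction v) = direction (rot R v) := by
  rw [direction, direction, rot_smul, norm_rot]

lemma exists_rot_eq (f : EuclideanSpace ℝ (Fin d) ≃ₗᵢ[ℝ] EuclideanSpace ℝ (Fin d)) :
    ∃ Q : OrthGroup d, ∀ v, rot Q v = f v := by
  let b := EuclideanSpace.basisFun (Fin d) ℝ
  refine ⟨⟨_, f.toMatrix_mem_unitaryGroup b b⟩, fun v => ?_⟩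
  rw [rot, Matrix.toEuclideanLin_eq_toLin_orthonormal, Matrix.toLin_toMatrix]
  rfl

lemma measurable_rot : Measurable fun p : OrthGroup d × EuclideanSpace ℝ (Fin d) =>
    rot p.1 p.2 := by
  have h : ∀ i j, Measurable fun R : OrthGroup d => (R : Matrix (Fin d) (Fin d) ℝ) i j :=
    fun i j => ((continuous_subtype_val.matrix_elem i j)).measurable
  have : (fun p : OrthGroup d × EuclideanSpace ℝ (Fin d) => rot p.1 p.2)
      = fun p => WithLp.toLp 2 fun i => ∑ j, (p.1 : Matrix (Fin d) (Fin d) ℝ) i j * p.2 j := by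
    ext p i
    exact rot_apply _ _ _
  rw [this]
  refine (MeasurableEquiv.toLp 2 (Fin d → ℝ)).measurable.comp (measurable_pi_lambda _ fun i => ?_)
  refine Finset.measurable_sum _ fun j _ => ?_
  exact ((h i j).comp measurable_fst).mul (by fun_prop)

lemma Measurable.rot {α : Type*} [MeasurableSpace α] {f : α → OrthGroup d}
    {g : α → EuclideanSpace ℝ (Fin d)} (hf : Measurable f) (hg : Measurable g) :
    Measurable fun a => rot (f a) (g a) := by
  have h : (fun a => _root_.rot (f a) (g a))
      = (fun p : OrthGroup d × EuclideanSpace ℝ (Fin d) => _root_.rot p.1 p.2)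
        ∘ fun a => (f a, g a) := rfl
  rw [h]
  exact Measurable.comp measurable_rot (hf.prodMk hg)

lemma Measurable.rotInv {α : Type*} [MeasurableSpace α] {f : α → OrthGroup d}
    {g : α → EuclideanSpace ℝ (Fin d)} (hf : Measurable f) (hg : Measurable g) :
    Measurable fun a => rotInv (f a) (g a) := by
  simp_rw [rotInv_eq_rot_inv]
  exact (continuous_inv.measurable.comp hf).rot hg

lemma measurable_rot_left (R : OrthGroup d) : Measurable (rot R) :=
  measurable_const.rot measurable_id

lemma map_rot_stdG (R : OrthGroup d) : (stdG d).map (rot R) = stdG d := stdGaussian_map (rotIso R)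

/-- The random rotation of a fixed frame has the same law for all frames that are related by an
isometry. -/
lemma haarO_isometry_comp (f : EuclideanSpace ℝ (Fin d) ≃ₗᵢ[ℝ] EuclideanSpace ℝ (Fin d))
    (p : (EuclideanSpace ℝ (Fin d) → EuclideanSpace ℝ (Fin d)) → Prop) :
    haarO d {R | p fun v => rot R (f v)} = haarO d {R | p (rot R)} := by
  obtain ⟨Q, hQ⟩ := exists_rot_eq f
  rw [← measure_preimage_mul_right (haarO d) Q {R | p (rot R)}]
  congr 1
  ext R
  have : rot (R * Q) = fun v => rot R (f v) := by
    ext v : 1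
    rw [rot_mul, hQ]
  simp [this]

/-- If almost all sections of `A` in one direction have measure `c`, then the sections in the other
direction have average measure `c`. -/
lemma lintegral_measure_section {α β : Type*} [MeasurableSpace α] [MeasurableSpace β]
    {μ : Measure α} {ν : Measure β} [IsProbabilityMeasure μ] [IsProbabilityMeasure ν]
    {A : Set (α × β)} (hA : MeasurableSet A) {c : ℝ≥0∞} (h : ∀ᵐ b ∂ν, μ {a | (a, b) ∈ A} = c) :
    ∫⁻ a, ν {b | (a, b) ∈ A} ∂μ = c := by
  have h1 := Measure.prod_apply (μ := μ) (ν := ν) hA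
  have h2 := Measure.prod_apply_symm (μ := μ) (ν := ν) hA
  calc _ = ∫⁻ b, μ {a | (a, b) ∈ A} ∂ν := h1.symm.trans h2
    _ = ∫⁻ _b, c ∂ν := lintegral_congr_ae h
    _ = c := by simp

/-- The law of a rotated unit vector is the only rotation-invariant probability measure on the
sphere. -/
lemma haarO_rot_mem {σ : Measure (EuclideanSpace ℝ (Fin d))} [IsProbabilityMeasure σ]
    (h1 : ∀ᵐ v ∂σ, ‖v‖ = 1) (hinv : ∀ R : OrthGroup d, σ.map (rot R) = σ)
    {x : EuclideanSpace ℝ (Fin d)} (hx : ‖x‖ = 1) {S : Set (EuclideanSpace ℝ (Fin d))}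
    (hS : MeasurableSet S) : haarO d {R | rot R x ∈ S} = σ S := by
  have h := lintegral_measure_section (μ := haarO d) (ν := σ) (A := {p | rot p.1 p.2 ∈ S})
    (measurable_rot hS) (c := haarO d {R | rot R x ∈ S}) (by
      -- a reflection carries `x` to `v`
      filter_upwards [h1] with v hv
      have := haarO_isometry_comp (Submodule.reflection (ℝ ∙ (x - v))ᗮ) fun g => g x ∈ S
      simpa [Submodule.reflection_sub (hx.trans hv.symm)] using this)
  rw [← h]
  have : ∀ R : OrthGroup d, σ {b | (R, b) ∈ {p : OrthGroup d × EuclideanSpace ℝ (Fin d) |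
      rot p.1 p.2 ∈ S}} = σ S := by
    intro R
    nth_rw 2 [← hinv R]
    rw [Measure.map_apply (measurable_rot_left R) hS]
    rfl
  simp_rw [this]
  simp

lemma ae_norm_direction_stdG (hd : 0 < d) : ∀ᵐ g ∂(stdG d), ‖direction g‖ = 1 := by
  have : NeZero d := ⟨hd.ne'⟩
  have hv : EuclideanSpace.single (0 : Fin d) (1 : ℝ) ≠ 0 := by simp
  filter_upwards [stdG_ae_inner_ne_zero hv] with g hg
  exact norm_direction (by rintro rfl; simp at hg)

instance : IsProbabilityMeasure ((stdG d).map direction) :=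
  Measure.isProbabilityMeasure_map measurable_direction.aemeasurable

lemma map_rot_map_direction (R : OrthGroup d) :
    ((stdG d).map direction).map (rot R) = (stdG d).map direction := by
  rw [Measure.map_map (measurable_rot_left R) measurable_direction]
  nth_rw 2 [← map_rot_stdG R]
  rw [Measure.map_map measurable_direction (measurable_rot_left R)]
  congr 1
  ext g : 1
  exact rot_direction R g

/-- A randomly rotated unit vector is distributed as the direction of a Gaussian vector. -/
lemma haarO_rot_mem_eq_stdG {x : EuclideanSpace ℝ (Fin d)} (hx : ‖x‖ = 1) (hd : 0 < d)
    {S : Set (EuclideanSpace ℝ (Fin d))} (hS : MeasurableSet S) :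
    (haarO d).real {R | rot R x ∈ S} = (stdG d).real {g | direction g ∈ S} := by
  have h1 : ∀ᵐ v ∂((stdG d).map direction), ‖v‖ = 1 :=
    (ae_map_iff measurable_direction.aemeasurable
      (measurableSet_eq_fun measurable_norm measurable_const)).2 (ae_norm_direction_stdG hd)
  rw [Measure.real, haarO_rot_mem h1 map_rot_map_direction hx hS,
    Measure.map_apply measurable_direction hS]
  rfl

/-- Given `R x`, the vector `R w` is a uniformly random direction orthogonal to it. -/
lemma haarO_inner_rot_le {x w : EuclideanSpace ℝ (Fin d)} (hx : ‖x‖ = 1) (hw : ‖w‖ = 1)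
    (hxw : inner ℝ x w = 0) {F : EuclideanSpace ℝ (Fin d) → EuclideanSpace ℝ (Fin d)}
    (hF : Measurable F) {t B : ℝ}
    (hB : ∀ a, (stdG d).real {h | t * ‖a‖ < |inner ℝ a (direction (orthPart x h))|} ≤ B) :
    (haarO d).real {R | t * ‖F (rot R x)‖ < |inner ℝ (F (rot R x)) (rot R w)|} ≤ B := by
  have hm1 : Measurable fun R : OrthGroup d => rot R x :=
    measurable_id.rot measurable_const
  have hm2 : Measurable (orthPart x) := by unfold orthPart; fun_prop
  have hm3 := measurable_direction (d := d)
  have hm4 : Measurable fun p : OrthGroup d × EuclideanSpace ℝ (Fin d) =>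
      rot p.1 (direction (orthPart x p.2)) :=
    measurable_fst.rot ((hm3.comp hm2).comp measurable_snd)
  have hA : MeasurableSet {p : OrthGroup d × EuclideanSpace ℝ (Fin d) |
      t * ‖F (rot p.1 x)‖ < |inner ℝ (F (rot p.1 x)) (rot p.1 (direction (orthPart x p.2)))|} := by
    have hm5 : Measurable fun p : OrthGroup d × EuclideanSpace ℝ (Fin d) => F (rot p.1 x) :=
      hF.comp (hm1.comp measurable_fst)
    exact measurableSet_lt (hm5.norm.const_mul t) (hm5.inner hm4).abs
  have h := lintegral_measure_section (μ := haarO d) (ν := stdG d) hA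
    (c := haarO d {R | t * ‖F (rot R x)‖ < |inner ℝ (F (rot R x)) (rot R w)|}) (by
      filter_upwards [stdG_ae_inner_ne_zero (v := w) (by rintro rfl; simp at hw)] with g hg
      have hP : orthPart x g ≠ 0 := by
        intro h0
        have := inner_orthPart_comm x w g
        rw [h0, inner_zero_right, orthPart, hxw, zero_smul, sub_zero] at this
        exact hg this.symm
      set v := direction (orthPart x g) with hv
      have hv1 : ‖v‖ = 1 := norm_direction hP
      have hxv : inner ℝ x v = 0 := by
        rw [hv, direction, real_inner_smul_right, inner_orthPart hx, mul_zero]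
      -- the reflection that carries `w` to `v` fixes `x`, which is orthogonal to both
      have hfix : Submodule.reflection (ℝ ∙ (w - v))ᗮ x = x := by
        rw [Submodule.reflection_eq_self_iff, Submodule.mem_orthogonal_singleton_iff_inner_left,
          inner_sub_right, hxw, hxv, sub_zero]
      have := haarO_isometry_comp (Submodule.reflection (ℝ ∙ (w - v))ᗮ)
        fun f => t * ‖F (f x)‖ < |inner ℝ (F (f x)) (f w)|
      simp only [hfix, Submodule.reflection_sub (hw.trans hv1.symm)] at this
      exact this)
  have hB0 : 0 ≤ B := measureReal_nonneg.trans (hB 0)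
  refine ENNReal.toReal_le_of_le_ofReal hB0 ?_
  rw [← h]
  calc _ ≤ ∫⁻ _R, ENNReal.ofReal B ∂(haarO d) := by
        refine lintegral_mono fun R => ?_
        have := hB (rotInv R (F (rot R x)))
        rw [norm_rotInv] at this
        rw [← ENNReal.ofReal_toReal (measure_ne_top (stdG d) _)]
        refine ENNReal.ofReal_le_ofReal (le_trans (le_of_eq ?_) this)
        simp only [Measure.real, Set.mem_ofPred_eq, real_inner_comm _ (rotInv R _), inner_rotInv]
        simp only [real_inner_comm]
    _ = _ := by simp

/-! ### The uniform measure on the sphere -/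

lemma sphereUniform_isProbabilityMeasure (hd : 0 < d) :
    IsProbabilityMeasure (sphereUniform d) := by
  have : NeZero d := ⟨hd.ne'⟩
  refine ⟨?_⟩
  rw [sphereUniform, Measure.smul_apply, smul_eq_mul]
  exact ENNReal.inv_mul_cancel (by
    rw [Ne, Measure.measure_univ_eq_zero]; exact Measure.toSphere_ne_zero _) (measure_ne_top _ _)

lemma map_rot_sphereUniform (R : OrthGroup d) :
    ((sphereUniform d).map (Subtype.val : _ → EuclideanSpace ℝ (Fin d))).map (rot R)
      = (sphereUniform d).map Subtype.val := by
  ext S hS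
  rw [Measure.map_apply (measurable_rot_left R) hS,
    Measure.map_apply measurable_subtype_coe (measurable_rot_left R hS),
    Measure.map_apply measurable_subtype_coe hS, sphereUniform, Measure.smul_apply,
    Measure.smul_apply, Measure.toSphere_apply' _ (measurable_subtype_coe (measurable_rot_left R hS)),
    Measure.toSphere_apply' _ (measurable_subtype_coe hS)]
  congr 2
  refine Eq.trans ?_ ((rotIso R).measurePreserving.measure_preimage_equiv
    (f := (rotIso R).toMeasurableEquiv) _)
  congr 1
  ext v
  simp only [Set.mem_smul, Set.mem_image, Set.mem_preimage, Subtype.exists, exists_and_right,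
    exists_eq_right, LinearIsometryEquiv.coe_toMeasurableEquiv, rotIso_apply]
  constructor
  · rintro ⟨r, hr, w, ⟨hw, hwS⟩, rfl⟩
    refine ⟨r, hr, rot R w, ⟨?_, hwS⟩, (rot_smul R r w).symm⟩
    simpa [norm_rot] using hw
  · rintro ⟨r, hr, w, ⟨hw, hwS⟩, h⟩
    refine ⟨r, hr, rotInv R w, ⟨?_, by rwa [rot_rotInv]⟩, ?_⟩
    · simpa [norm_rotInv] using hw
    · rw [← rotInv_rot R v, ← h, rotInv_eq_rot_inv, rotInv_eq_rot_inv, rot_smul]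

lemma map_val_sphereUniform (hd : 0 < d) :
    (sphereUniform d).map (Subtype.val : _ → EuclideanSpace ℝ (Fin d))
      = (stdG d).map direction := by
  have := sphereUniform_isProbabilityMeasure hd
  have := Measure.isProbabilityMeasure_map (μ := sphereUniform d)
    (measurable_subtype_coe (p := (· ∈ Metric.sphere (0 : EuclideanSpace ℝ (Fin d)) 1))).aemeasurable
  have : NeZero d := ⟨hd.ne'⟩
  have hx : ‖EuclideanSpace.single (0 : Fin d) (1 : ℝ)‖ = 1 := by simp
  have h1 : ∀ᵐ v ∂((stdG d).map direction), ‖v‖ = 1 :=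
    (ae_map_iff measurable_direction.aemeasurable
      (measurableSet_eq_fun measurable_norm measurable_const)).2 (ae_norm_direction_stdG hd)
  have h2 : ∀ᵐ v ∂((sphereUniform d).map (Subtype.val : _ → EuclideanSpace ℝ (Fin d))), ‖v‖ = 1 :=
    (ae_map_iff measurable_subtype_coe.aemeasurable
      (measurableSet_eq_fun measurable_norm measurable_const)).2
      (Filter.Eventually.of_forall fun v => by simp)
  ext S hS
  rw [← haarO_rot_mem h1 map_rot_map_direction hx hS,
    ← haarO_rot_mem h2 map_rot_sphereUniform hx hS]

lemma sphereCoordLaw_eq_map_direction (hd : 0 < d) (j : Fin d) :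
    sphereCoordLaw j = (stdG d).map fun g => (direction g : EuclideanSpace ℝ (Fin d)) j := by
  have h : Measurable fun v : EuclideanSpace ℝ (Fin d) => v j := by fun_prop
  have e1 : sphereCoordLaw j
      = ((sphereUniform d).map (Subtype.val : _ → EuclideanSpace ℝ (Fin d))).map fun v => v j := by
    rw [Measure.map_map h measurable_subtype_coe]; rfl
  rw [e1, map_val_sphereUniform hd, Measure.map_map h measurable_direction]
  rfl

/-! ### The error of EDEN -/

/-- Coordinate-wise quantization: every coordinate is replaced by its centroid. -/
noncomputable def quantVec {d K : ℕ} (a : Fin K → ℝ) (enc : ℝ → Fin K)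
    (u : EuclideanSpace ℝ (Fin d)) : EuclideanSpace ℝ (Fin d) :=
  decodeVec a (encodeVec enc u)

lemma measurable_quantVec {K : ℕ} (a : Fin K → ℝ) {enc : ℝ → Fin K} (henc : Measurable enc) :
    Measurable (quantVec a enc : EuclideanSpace ℝ (Fin d) → _) := by
  have h : Measurable fun u : EuclideanSpace ℝ (Fin d) => fun j => a (enc (u j)) :=
    measurable_pi_lambda _ fun j =>
      (measurable_of_finite a).comp (henc.comp (by fun_prop))
  exact (MeasurableEquiv.toLp 2 (Fin d → ℝ)).measurable.comp h

lemma rawRec_eq {K : ℕ} (a : Fin K → ℝ) (enc : ℝ → Fin K) (R : OrthGroup d)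
    (x : EuclideanSpace ℝ (Fin d)) : rawRec a enc R x = rotInv R (quantVec a enc (rot R x)) := rfl

lemma norm_quantVec_sub {K : ℕ} (a : Fin K → ℝ) (enc : ℝ → Fin K)
    (u : EuclideanSpace ℝ (Fin d)) :
    ‖quantVec a enc u - u‖ = ‖coordMap (quantErr a enc) u‖ := by
  refine (sq_eq_sq₀ (norm_nonneg _) (norm_nonneg _)).1 ?_
  rw [norm_coordMap_sq, EuclideanSpace.real_norm_sq_eq]
  refine Finset.sum_congr rfl fun i _ => ?_
  rw [quantErr, sq_abs, ← neg_sq (u i - _), neg_sub]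
  rfl

lemma norm_coordMap_quantErr_scale {K : ℕ} {a q : Fin K → ℝ} (enc : ℝ → Fin K) {r : ℝ}
    (hr : 0 < r) (hq : ∀ i, a i = q i / r) (u : EuclideanSpace ℝ (Fin d)) :
    ‖coordMap (quantErr q fun z => enc (z / r)) (r • u)‖ = r * ‖quantVec a enc u - u‖ := by
  refine (sq_eq_sq₀ (norm_nonneg _) (by positivity)).1 ?_
  rw [norm_quantVec_sub, mul_pow, norm_coordMap_sq, norm_coordMap_sq, Finset.mul_sum]
  refine Finset.sum_congr rfl fun i _ => ?_
  rw [PiLp.smul_apply, smul_eq_mul, quantErr_scale enc hr hq, mul_pow]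

/-- The norm of the quantization residual of a randomly rotated unit vector, in terms of the
Gaussian mean squared error of the codebook scaled by `√d`. -/
lemma haarO_residual_tail {K : ℕ} {a q : Fin K → ℝ} {enc : ℝ → Fin K}
    (henc : IsNearestCode a enc) (hq : ∀ i, a i = q i / √d) {m M : ℝ}
    (hm : ∫ z, quantErr q (fun z => enc (z / √d)) z ^ 2 ∂(gaussianReal 0 1) ≤ m) (hM : m ≤ M)
    {l : ℝ} (hl : 0 < l) (hl' : l ≤ 1 / 16) {s : ℝ} (hs : 0 < s) (hsd : 8 * s ≤ d)
    {x : EuclideanSpace ℝ (Fin d)} (hx : ‖x‖ = 1) :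
    (haarO d).real {R | √((1 + 16 * momentConst M * l) * m + s / (l * d)) + √(8 * s / d)
      < ‖quantVec a enc (rot R x) - rot R x‖} ≤ 3 * Real.exp (-s) := by
  have hd : (0 : ℝ) < d := by linarith
  have hr : 0 < √(d : ℝ) := Real.sqrt_pos.2 hd
  have hnear := henc.scale hr hq
  set D := quantErr q (fun z => enc (z / √d)) with hD
  have hlip : LipschitzWith 1 D := hnear.lipschitzWith
  have hmeas : Measurable fun u : EuclideanSpace ℝ (Fin d) => ‖coordMap D (√d • u)‖ := by
    have hc := hlip.continuous.measurable
    have e : (fun u : EuclideanSpace ℝ (Fin d) => ‖coordMap D (√d • u)‖)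
        = fun u => √(∑ i, D (√d * u i) ^ 2) := by
      ext u
      rw [← Real.sqrt_sq (norm_nonneg _), norm_coordMap_sq]
      simp
    rw [e]
    fun_prop
  set I := ∫ z, D z ^ 2 ∂(gaussianReal 0 1) with hI
  have key := stdG_coordMap_direction_tail (d := d) hlip (quantErr_nonneg _ _)
    (hm.trans hM) hl hl' hs hsd
  rw [← hI] at key
  have hlaw := haarO_rot_mem_eq_stdG hx (by exact_mod_cast hd)
    (S := {u | √((1 + 16 * momentConst M * l) * (d * I) + s / l) + √(8 * s)
      < ‖coordMap D (√d • u)‖}) (measurableSet_lt measurable_const hmeas)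
  refine (measureReal_mono fun R hR => ?_).trans (hlaw.trans_le key)
  simp only [Set.mem_ofPred_eq] at hR ⊢
  rw [hD, norm_coordMap_quantErr_scale enc hr hq]
  refine lt_of_le_of_lt ?_ (mul_lt_mul_of_pos_left hR hr)
  have hκ := momentConst_pos M
  rw [mul_add, ← Real.sqrt_mul hd.le, ← Real.sqrt_mul hd.le]
  have e1 : (d : ℝ) * (8 * s / d) = 8 * s := by field_simp
  have e2 : (d : ℝ) * ((1 + 16 * momentConst M * l) * m + s / (l * d))
      = (1 + 16 * momentConst M * l) * (d * m) + s / l := by field_simp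
  rw [e1, e2]
  gcongr

/-- The inner product of a function of `R x` with `R z`, for `z` orthogonal to `x`. -/
lemma haarO_inner_rot_tail {x z : EuclideanSpace ℝ (Fin d)} (hx : ‖x‖ = 1) (hz : ‖z‖ ≤ 1)
    (hxz : inner ℝ x z = 0) {F : EuclideanSpace ℝ (Fin d) → EuclideanSpace ℝ (Fin d)}
    (hF : Measurable F) {s : ℝ} (hs : 0 < s) (hsd : 32 * s ≤ d) :
    (haarO d).real {R | 8 * √(s / d) * ‖F (rot R x)‖ < |inner ℝ (F (rot R x)) (rot R z)|}
      ≤ 6 * Real.exp (-s) := by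
  by_cases h0 : z = 0
  · have : {R : OrthGroup d | 8 * √(s / d) * ‖F (rot R x)‖ < |inner ℝ (F (rot R x)) (rot R z)|}
        = ∅ := by
      refine Set.eq_empty_of_forall_notMem fun R hR => ?_
      have e : rot R z = 0 := by rw [← norm_eq_zero, norm_rot, h0, norm_zero]
      simp only [Set.mem_ofPred_eq, e, inner_zero_right, abs_zero] at hR
      exact absurd hR (not_lt.2 (by positivity))
    rw [this, measureReal_empty]
    positivity
  have hdir : inner ℝ x (direction z) = 0 := by
    rw [direction, real_inner_smul_right, hxz, mul_zero]
  refine (measureReal_mono fun R hR => ?_).trans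
    (haarO_inner_rot_le hx (norm_direction h0) hdir hF
      fun a => stdG_inner_direction_orthPart_tail hx a hs hsd)
  simp only [Set.mem_ofPred_eq] at hR ⊢
  refine hR.trans_le ?_
  have hn : ‖z‖ ≠ 0 := norm_ne_zero_iff.2 h0
  have e : z = ‖z‖ • direction z := by
    rw [direction, smul_smul, mul_inv_cancel₀ hn, one_smul]
  conv_lhs => rw [e, rot_smul, real_inner_smul_right, abs_mul, abs_norm]
  exact mul_le_of_le_one_left (abs_nonneg _) hz

/-- The error of the EDEN estimate: only the component of `y` orthogonal to `x` contributes. -/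
lemma abs_edenIP_sub_le {K : ℕ} (a : Fin K → ℝ) (enc : ℝ → Fin K) (R : OrthGroup d)
    {x y : EuclideanSpace ℝ (Fin d)} (hx : ‖x‖ = 1)
    (hF : ‖quantVec a enc (rot R x) - rot R x‖ ^ 2 ≤ 1 / 2) :
    |edenIP a enc R x y - inner ℝ x y|
      ≤ 4 * |inner ℝ (quantVec a enc (rot R x) - rot R x) (rot R (orthPart x y))| := by
  set u := rot R x
  set w := quantVec a enc u
  have hu : ‖u‖ = 1 := by rw [norm_rot, hx]
  have hxX : inner ℝ x (rawRec a enc R x) = inner ℝ u w := by rw [rawRec_eq, inner_rotInv]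
  have huw : 1 / 4 ≤ inner ℝ u w := by
    rw [@norm_sub_sq_real, hu, real_inner_comm] at hF
    nlinarith [sq_nonneg ‖w‖]
  have hy : y = inner ℝ x y • x + orthPart x y := by rw [orthPart]; abel
  have hz : inner ℝ (rawRec a enc R x) (orthPart x y)
      = inner ℝ (w - u) (rot R (orthPart x y)) := by
    rw [inner_sub_left, inner_rot_rot, inner_orthPart hx, sub_zero, real_inner_comm, rawRec_eq,
      inner_rotInv, real_inner_comm]
  have e : edenIP a enc R x y - inner ℝ x y
      = inner ℝ (w - u) (rot R (orthPart x y)) / inner ℝ u w := by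
    rw [edenIP, real_inner_smul_left, hxX]
    nth_rw 1 [hy]
    rw [inner_add_right, real_inner_smul_right, hz, real_inner_comm x, hxX]
    have : inner ℝ u w ≠ 0 := by linarith
    field_simp
    ring
  rw [e, abs_div, abs_of_pos (by linarith : 0 < inner ℝ u w), div_le_iff₀ (by linarith)]
  nlinarith [abs_nonneg (inner ℝ (w - u) (rot R (orthPart x y)))]

lemma exp_neg_two_mul_log {δ : ℝ} (hδ : 0 < δ) :
    Real.exp (-(2 * Real.log (4 / δ))) = δ ^ 2 / 16 := by
  have : -(2 * Real.log (4 / δ)) = Real.log ((δ / 4) ^ 2) := by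
    rw [Real.log_pow, Real.log_div hδ.ne' (by norm_num), Real.log_div (by norm_num) hδ.ne']
    push_cast
    ring
  rw [this, Real.exp_log (by positivity)]
  ring

lemma log_four_div_pos {δ : ℝ} (hδ : 0 < δ) (hδ1 : δ < 1) : 0 < Real.log (4 / δ) :=
  Real.log_pos (by rw [lt_div_iff₀ hδ]; linarith)

lemma momentConst_one_le : momentConst 1 ≤ 24 := by
  have := Real.exp_one_lt_d9
  have h2 : Real.exp (1 + 1) = Real.exp 1 ^ 2 := by rw [← Real.exp_nat_mul]; norm_num
  rw [momentConst, h2]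
  nlinarith [Real.exp_pos 1]

/-- The error bound of EDEN. With `L = log (4 / δ)`, the residual bound is used twice at level
`exp (-2 L) = δ² / 16`: with `l = 1 / 16` for the error itself, and with the small value
`l = 1 / 4000`, for which the bound is close to the mean squared error `1 - 2 / π` of two levels,
to keep the denominator away from zero. -/
lemma edenErrorBound_main {δ : ℝ} (hδ : 0 < δ) (hδ1 : δ < 1)
    (hL : Real.log (4 / δ) ≤ 1 / 10 ^ 6 * d) {b : ℕ} (hb : 1 ≤ b) :
    EdenErrorBound d b
      (2000 * (((2 : ℝ) ^ b)⁻¹ * √(Real.log (4 / δ) / d) + Real.log (4 / δ) / d)) δ := by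
  rintro a enc ⟨⟨q, hq, hqa⟩, henc⟩ x y hx hy
  have hL0 := log_four_div_pos hδ hδ1
  set L := Real.log (4 / δ) with hLdef
  have hd : (0 : ℝ) < d := by linarith
  have hr : 0 < √(d : ℝ) := Real.sqrt_pos.2 hd
  have hnear := henc.scale hr hqa
  have m1 := hq.gaussian_mse_le hnear
  have m2 := hq.gaussian_mse_le_one_sub hb hnear
  have hpi : 1 - 2 / Real.pi ≤ 0.3651 := by
    have : (0.6349 : ℝ) ≤ 2 / Real.pi := by
      rw [le_div_iff₀ Real.pi_pos]; linarith [Real.pi_lt_d2]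
    linarith
  set I := ∫ z, quantErr q (fun z => enc (z / √d)) z ^ 2 ∂(gaussianReal 0 1) with hI
  have hI0 : 0 ≤ I := integral_nonneg fun z => sq_nonneg _
  have hI1 : I ≤ 0.3651 := m2.trans hpi
  have hκ := momentConst_one_le
  have hκ0 := momentConst_pos 1
  have hLd : L / d ≤ 1 / 10 ^ 6 := (div_le_iff₀ hd).2 hL
  have t1 := haarO_residual_tail henc hqa hI.ge (M := 1) (by linarith) (l := 1 / 16) (by norm_num)
    le_rfl (s := 2 * L) (by linarith) (by linarith) hx
  have t2 := haarO_residual_tail henc hqa hI.ge (M := 1) (by linarith) (l := 1 / 4000) (by norm_num)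
    (by norm_num) (s := 2 * L) (by linarith) (by linarith) hx
  have t3 := haarO_inner_rot_tail hx (z := orthPart x y) ((norm_orthPart_le hx y).trans hy.le)
    (inner_orthPart hx y) (F := fun u => quantVec a enc u - u)
    ((measurable_quantVec a henc.1).sub measurable_id) (s := 2 * L) (by linarith) (by linarith)
  rw [exp_neg_two_mul_log hδ] at t1 t2 t3
  have q0 := Real.sqrt_nonneg (L / d)
  have q1 : √(L / d) ≤ 1 / 1000 := by
    rw [Real.sqrt_le_left (by norm_num)]; linarith
  have q2 : √(L / d) ^ 2 = L / d := Real.sq_sqrt (by positivity)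
  have qc : ∀ c : ℝ, 0 ≤ c → √(c ^ 2 * (L / d)) = c * √(L / d) := fun c hc => by
    rw [Real.sqrt_mul (by positivity), Real.sqrt_sq hc]
  have e8 : √(8 * (2 * L) / d) = 4 * √(L / d) := by
    rw [← qc 4 (by norm_num)]; congr 1; ring
  have hK : (0 : ℝ) < 2 ^ b := by positivity
  -- the two thresholds for the norm of the residual
  have b1 : √((1 + 16 * momentConst 1 * (1 / 16)) * I + 2 * L / (1 / 16 * d))
      + √(8 * (2 * L) / d) ≤ 39 * (2 ^ b)⁻¹ + 10 * √(L / d) := by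
    have : √((1 + 16 * momentConst 1 * (1 / 16)) * I + 2 * L / (1 / 16 * d))
        ≤ 39 * (2 ^ b)⁻¹ + 6 * √(L / d) := by
      rw [Real.sqrt_le_left (by positivity)]
      have e1 : 2 * L / (1 / 16 * d) = 32 * (L / d) := by field_simp; norm_num
      have e2 : (1 + 16 * momentConst 1 * (1 / 16)) * I ≤ 25 * (60 / (2 ^ b) ^ 2) :=
        mul_le_mul (by linarith) m1 hI0 (by norm_num)
      have e3 : 25 * (60 / (2 ^ b) ^ 2) = 1500 * ((2 ^ b : ℝ)⁻¹) ^ 2 := by field_simp; norm_num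
      have : 0 ≤ (2 ^ b : ℝ)⁻¹ * √(L / d) := by positivity
      have : 0 ≤ L / d := by positivity
      nlinarith [sq_nonneg ((2 ^ b : ℝ)⁻¹)]
    linarith
  have b2 : √((1 + 16 * momentConst 1 * (1 / 4000)) * I + 2 * L / (1 / 4000 * d))
      + √(8 * (2 * L) / d) ≤ 0.66 := by
    have : √((1 + 16 * momentConst 1 * (1 / 4000)) * I + 2 * L / (1 / 4000 * d)) ≤ 0.65 := by
      rw [Real.sqrt_le_left (by norm_num)]
      have e1 : 2 * L / (1 / 4000 * d) = 8000 * (L / d) := by field_simp; norm_num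
      have e2 : (1 + 16 * momentConst 1 * (1 / 4000)) * I ≤ 1.1 * 0.3651 :=
        mul_le_mul (by linarith) hI1 hI0 (by norm_num)
      linarith
    linarith
  have b3 : 8 * √(2 * L / d) ≤ 12 * √(L / d) := by
    have : √(2 * L / d) ≤ √(1.5 ^ 2 * (L / d)) := by
      apply Real.sqrt_le_sqrt
      have : 0 ≤ L / d := by positivity
      rw [mul_div_assoc]
      linarith
    rw [qc _ (by norm_num)] at this
    linarith
  set T := 2000 * (((2 : ℝ) ^ b)⁻¹ * √(L / d) + L / d) with hT
  refine (measureReal_mono (s₂ := ({R | √((1 + 16 * momentConst 1 * (1 / 16)) * I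
      + 2 * L / (1 / 16 * d)) + √(8 * (2 * L) / d) < ‖quantVec a enc (rot R x) - rot R x‖} ∪
      {R | √((1 + 16 * momentConst 1 * (1 / 4000)) * I + 2 * L / (1 / 4000 * d))
        + √(8 * (2 * L) / d) < ‖quantVec a enc (rot R x) - rot R x‖}) ∪
      {R | 8 * √(2 * L / d) * ‖quantVec a enc (rot R x) - rot R x‖ <
        |inner ℝ (quantVec a enc (rot R x) - rot R x) (rot R (orthPart x y))|}) fun R hR => ?_).trans
      ((measureReal_union_le _ _).trans ((add_le_add (measureReal_union_le _ _) le_rfl).trans ?_))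
  · simp only [Set.mem_ofPred_eq, Set.mem_union] at hR ⊢
    by_contra! hcon
    obtain ⟨⟨c1, c2⟩, c3⟩ := hcon
    set N := ‖quantVec a enc (rot R x) - rot R x‖
    have hN0 : 0 ≤ N := norm_nonneg _
    have hN : N ^ 2 ≤ 1 / 2 := by nlinarith
    have herr := abs_edenIP_sub_le a enc R (y := y) hx hN
    have : 8 * √(2 * L / d) * N ≤ 12 * √(L / d) * (39 * (2 ^ b)⁻¹ + 10 * √(L / d)) :=
      mul_le_mul b3 (c1.trans b1) hN0 (by positivity)
    have : 0 ≤ (2 ^ b : ℝ)⁻¹ * √(L / d) := by positivity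
    have : 0 ≤ L / d := by positivity
    have e : 12 * √(L / d) * (39 * (2 ^ b)⁻¹ + 10 * √(L / d))
        = 468 * ((2 ^ b : ℝ)⁻¹ * √(L / d)) + 120 * (L / d) := by
      linear_combination 120 * q2
    linarith
  · nlinarith

/-! ### Optimal codebooks of the coordinates of a random point of the sphere -/

lemma map_eval_stdG (j : Fin d) : (stdG d).map (fun g => g j) = gaussianReal 0 1 := by
  have h := map_inner_stdG (d := d) (v := EuclideanSpace.single j 1) (by simp)
  simpa [EuclideanSpace.inner_single_left] using h

lemma integral_eval_stdG {f : ℝ → ℝ} (hf : Measurable f) (j : Fin d) :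
    ∫ g, f (g j) ∂(stdG d) = ∫ z, f z ∂(gaussianReal 0 1) := by
  rw [← map_eval_stdG j, integral_map (by fun_prop) hf.aestronglyMeasurable]

lemma integrable_eval_stdG {f : ℝ → ℝ} (hf : Integrable f (gaussianReal 0 1)) (j : Fin d) :
    Integrable (fun g => f (g j)) (stdG d) := by
  rw [← map_eval_stdG j] at hf
  exact hf.comp_measurable (by fun_prop)

lemma integrable_and_integral_exp_norm_sq_sub {l : ℝ} (hl : |l| ≤ 1 / 4) :
    Integrable (fun g => Real.exp (l * (‖g‖ ^ 2 - d))) (stdG d) ∧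
    ∫ g, Real.exp (l * (‖g‖ ^ 2 - d)) ∂(stdG d) ≤ Real.exp (d * (2 * l ^ 2)) := by
  have hi := integrable_exp_mul_sq_sub_one hl
  have e : ∀ w : Fin d → ℝ, Real.exp (l * (‖WithLp.toLp 2 w‖ ^ 2 - d))
      = ∏ i, Real.exp (l * (w i ^ 2 - 1)) := by
    intro w
    rw [← Real.exp_sum, ← Finset.mul_sum, Finset.sum_sub_distrib,
      EuclideanSpace.real_norm_sq_eq]
    simp
  rw [stdG, ← map_pi_eq_stdGaussian, integrable_map_measure (by fun_prop) (by fun_prop),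
    integral_map (by fun_prop) (by fun_prop)]
  simp only [Function.comp_def, e]
  refine ⟨Integrable.fintype_prod (f := fun _ z => Real.exp (l * (z ^ 2 - 1))) fun _ => hi, ?_⟩
  rw [integral_fintype_prod_eq_prod (f := fun _ z => Real.exp (l * (z ^ 2 - 1))),
    Finset.prod_const, Finset.card_univ, Fintype.card_fin, Real.exp_nat_mul]
  exact pow_le_pow_left₀ (integral_nonneg fun w => (Real.exp_pos _).le)
    (integral_exp_mul_sq_sub_one_le hl) _

lemma sq_div_two_le_exp_add_exp_neg (x : ℝ) : x ^ 2 / 2 ≤ Real.exp x + Real.exp (-x) := by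
  rcases le_total 0 x with h | h
  · linarith [Real.quadratic_le_exp_of_nonneg h, Real.exp_pos (-x)]
  · have := Real.quadratic_le_exp_of_nonneg (x := -x) (by linarith)
    rw [neg_sq] at this
    linarith [Real.exp_pos x]

/-- The fluctuations of the norm of a Gaussian vector are bounded independently of the dimension. -/
lemma integrable_and_integral_sqrt_sub_norm_sq (hd : 0 < d) :
    Integrable (fun g => (√d - ‖g‖) ^ 2) (stdG d) ∧
    ∫ g, (√d - ‖g‖) ^ 2 ∂(stdG d) ≤ 80 := by
  have hd1 : (1 : ℝ) ≤ d := by exact_mod_cast hd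
  have sd : √(d : ℝ) ^ 2 = d := Real.sq_sqrt (by linarith)
  have sd1 : 1 ≤ √(d : ℝ) := Real.one_le_sqrt.2 hd1
  -- at this scale `l * (‖g‖ ^ 2 - d)` has bounded exponential moments, for every `d`
  set l := 1 / (4 * √(d : ℝ)) with hl
  have hl0 : 0 < l := by positivity
  have hl4 : l ≤ 1 / 4 := by rw [hl]; gcongr; linarith
  have hl2 : l ^ 2 * d = 1 / 16 := by
    rw [hl, div_pow, mul_pow, sd]; field_simp; norm_num
  obtain ⟨i1, b1⟩ := integrable_and_integral_exp_norm_sq_sub (d := d) (l := l)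
    (by rwa [abs_of_pos hl0])
  obtain ⟨i2, b2⟩ := integrable_and_integral_exp_norm_sq_sub (d := d) (l := -l)
    (by rwa [abs_neg, abs_of_pos hl0])
  have hexp : Real.exp (d * (2 * l ^ 2)) ≤ 1.2 := by
    rw [show (d : ℝ) * (2 * l ^ 2) = 1 / 8 by linear_combination 2 * hl2]
    refine (Real.exp_bound_div_one_sub_of_interval (by norm_num) (by norm_num)).trans ?_
    norm_num
  rw [neg_sq] at b2
  have hpt : ∀ g : EuclideanSpace ℝ (Fin d), (√d - ‖g‖) ^ 2
      ≤ 32 * (Real.exp (l * (‖g‖ ^ 2 - d)) + Real.exp (-l * (‖g‖ ^ 2 - d))) := by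
    intro g
    have h1 := abs_sqrt_sub_le (n := d) (by linarith) (norm_nonneg g)
    have h2 : d * (√d - ‖g‖) ^ 2 ≤ (‖g‖ ^ 2 - d) ^ 2 := by
      have := pow_le_pow_left₀ (by positivity) h1 2
      rwa [mul_pow, sq_abs, sq_abs, sd] at this
    have h3 := sq_div_two_le_exp_add_exp_neg (l * (‖g‖ ^ 2 - d))
    rw [← neg_mul] at h3
    have h4 : l ^ 2 * (d * (√d - ‖g‖) ^ 2) ≤ l ^ 2 * (‖g‖ ^ 2 - d) ^ 2 := by gcongr
    rw [← mul_assoc, hl2] at h4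
    nlinarith
  have iR := (i1.add i2).const_mul 32
  have iL : Integrable (fun g => (√d - ‖g‖) ^ 2) (stdG d) :=
    iR.mono' (by fun_prop) (Filter.Eventually.of_forall fun g => by
      rw [Real.norm_of_nonneg (sq_nonneg _)]; exact hpt g)
  refine ⟨iL, (integral_mono iL iR hpt).trans ?_⟩
  rw [integral_const_mul]
  simp only [Pi.add_apply]
  rw [integral_add i1 i2]
  linarith

/-- For an optimal codebook of the law of a coordinate of a random point of the sphere, the
Gaussian mean squared error of the codebook scaled by `√d`. -/
lemma IsTurboCode.gaussian_mse_le (hd : 0 < d) {b : ℕ} {a : Fin (2 ^ b) → ℝ}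
    {enc : ℝ → Fin (2 ^ b)} (h : IsTurboCode d b a enc) :
    ∫ z, quantErr (fun i => √d * a i) (fun z => enc (z / √d)) z ^ 2 ∂(gaussianReal 0 1)
      ≤ 240 / (2 ^ b) ^ 2 + 480 / d := by
  obtain ⟨hopt, henc⟩ := h
  have hd' : (0 : ℝ) < d := by exact_mod_cast hd
  have hr : 0 < √(d : ℝ) := Real.sqrt_pos.2 hd'
  have sd : √(d : ℝ) ^ 2 = d := Real.sq_sqrt hd'.le
  have hqa : ∀ i, a i = (fun i => √d * a i) i / √d := fun i => by field_simp
  have hnear := henc.scale hr hqa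
  set D := quantErr (fun i => √d * a i) (fun z => enc (z / √d)) with hD
  have hlip : LipschitzWith 1 D := hnear.lipschitzWith
  have hDc := hlip.continuous
  have hac := henc.lipschitzWith.continuous
  obtain ⟨iN, bN⟩ := integrable_and_integral_sqrt_sub_norm_sq hd
  have iD := integrable_sq_of_lipschitz hlip
  set I := ∫ z, D z ^ 2 ∂(gaussianReal 0 1) with hI
  have hdir := measurable_direction (d := d)
  have hdirj : ∀ j : Fin d, Measurable fun g : EuclideanSpace ℝ (Fin d) =>
      (direction g : EuclideanSpace ℝ (Fin d)) j := fun j => by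
    exact (by fun_prop : Measurable fun v : EuclideanSpace ℝ (Fin d) => v j).comp hdir
  obtain ⟨A, hA⟩ := exists_exponential_codebook b
  set ε : Fin d → EuclideanSpace ℝ (Fin d) → ℝ :=
    fun j g => (√d * (direction g : EuclideanSpace ℝ (Fin d)) j - g j) ^ 2 with hε
  have hεsum : ∀ g, ∑ j, ε j g ≤ (√d - ‖g‖) ^ 2 := by
    intro g
    have h1 := norm_smul_direction_sub_le (√d) g
    have h2 := pow_le_pow_left₀ (norm_nonneg _) h1 2
    rw [sq_abs, EuclideanSpace.real_norm_sq_eq] at h2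
    exact h2
  have hε0 : ∀ j g, 0 ≤ ε j g := fun j g => sq_nonneg _
  have hεm : ∀ j, Measurable (ε j) := fun j =>
    (((hdirj j).const_mul _).sub (by fun_prop)).pow_const 2
  have iε : ∀ j, Integrable (ε j) (stdG d) := fun j =>
    iN.mono' (hεm j).aestronglyMeasurable (Filter.Eventually.of_forall fun g => by
      rw [Real.norm_of_nonneg (hε0 j g)]
      exact (Finset.single_le_sum (fun i _ => hε0 i g) (Finset.mem_univ j)).trans (hεsum g))
  have iB := fun j : Fin d => integrable_eval_stdG (integrable_quantErr_bound b) j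
  -- the optimal error on the sphere, compared with that of the exponential codebook
  have hj : ∀ j : Fin d, ∫ g, D (√d * (direction g : EuclideanSpace ℝ (Fin d)) j) ^ 2 ∂(stdG d)
      ≤ ∫ g, (2 * ε j g + 2 * (2 * Real.exp |g j| / 2 ^ b) ^ 2) ∂(stdG d) := by
    intro j
    have e1 : ∀ z, D (√d * z) ^ 2 = d * ⨅ i, (z - a i) ^ 2 := by
      intro z
      rw [hD, quantErr_scale enc hr hqa, mul_pow, sd, henc.iInf_eq]
    have hle := hopt j fun i => A i / √d
    have hG : Measurable fun z : ℝ => ⨅ i, (z - A i / √d) ^ 2 :=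
      Measurable.iInf fun i => by fun_prop
    have hG' : Measurable fun z : ℝ => ⨅ i, (z - a i) ^ 2 :=
      Measurable.iInf fun i => by fun_prop
    rw [sphereCoordLaw_eq_map_direction hd, integral_map (hdirj j).aemeasurable
      hG'.aestronglyMeasurable, integral_map (hdirj j).aemeasurable hG.aestronglyMeasurable] at hle
    simp_rw [e1]
    rw [integral_const_mul]
    refine (mul_le_mul_of_nonneg_left hle hd'.le).trans ?_
    rw [← integral_const_mul]
    refine integral_mono_of_nonneg (Filter.Eventually.of_forall fun g =>
      mul_nonneg hd'.le (iInf_sub_sq_nonneg _ _)) (((iε j).const_mul 2).add ((iB j).const_mul 2))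
      (Filter.Eventually.of_forall fun g => ?_)
    obtain ⟨i, hi⟩ := hA (g j)
    have h1 := iInf_sub_sq_le (fun i => A i / √d) ((direction g : EuclideanSpace ℝ (Fin d)) j) i
    have h2 : d * ((direction g : EuclideanSpace ℝ (Fin d)) j - A i / √d) ^ 2
        = (√d * (direction g : EuclideanSpace ℝ (Fin d)) j - A i) ^ 2 := by
      rw [← sd, ← mul_pow]
      congr 1
      rw [sd]
      field_simp
    have h3 : (g j - A i) ^ 2 ≤ (2 * Real.exp |g j| / 2 ^ b) ^ 2 :=
      sq_le_sq' (by linarith [abs_nonneg (g j - A i), neg_abs_le (g j - A i)])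
        ((le_abs_self _).trans hi)
    have h4 := mul_le_mul_of_nonneg_left h1 hd'.le
    simp only [hε]
    nlinarith [sq_nonneg ((√d * (direction g : EuclideanSpace ℝ (Fin d)) j - g j)
      - (g j - A i))]
  have hsub : ∀ x y, D x ^ 2 ≤ 2 * D y ^ 2 + 2 * (y - x) ^ 2 := by
    intro x y
    have h1 := hlip.dist_le_mul x y
    simp only [Real.dist_eq, NNReal.coe_one, one_mul] at h1
    have h2 := sq_le_sq.2 ((abs_abs (x - y)).symm ▸ h1 : |D x - D y| ≤ |(|x - y|)|)
    rw [sq_abs] at h2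
    nlinarith [sq_nonneg (D x - 2 * D y)]
  -- back from the sphere to the Gaussian, coordinate by coordinate
  have hI_le : ∀ j : Fin d, I ≤ 6 * ∫ g, ε j g ∂(stdG d) + 240 / (2 ^ b) ^ 2 := by
    intro j
    have iDj := integrable_eval_stdG iD j
    have iDd : Integrable (fun g => D (√d * (direction g : EuclideanSpace ℝ (Fin d)) j) ^ 2)
        (stdG d) := by
      refine ((iDj.const_mul 2).add ((iε j).const_mul 2)).mono'
        ((hDc.measurable.comp ((hdirj j).const_mul _)).pow_const 2).aestronglyMeasurable
        (Filter.Eventually.of_forall fun g => ?_)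
      rw [Real.norm_of_nonneg (sq_nonneg _)]
      refine (hsub _ (g j)).trans (le_of_eq ?_)
      simp only [hε, Pi.add_apply]
      ring
    have h1 : I ≤ ∫ g, (2 * D (√d * (direction g : EuclideanSpace ℝ (Fin d)) j) ^ 2
        + 2 * ε j g) ∂(stdG d) := by
      rw [hI, ← integral_eval_stdG (f := fun z => D z ^ 2) (by fun_prop) j]
      exact integral_mono iDj ((iDd.const_mul 2).add ((iε j).const_mul 2))
        fun g => hsub (g j) _
    rw [integral_add (iDd.const_mul 2) ((iε j).const_mul 2), integral_const_mul,
      integral_const_mul] at h1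
    have h2 := hj j
    rw [integral_add ((iε j).const_mul 2) ((iB j).const_mul 2), integral_const_mul,
      integral_const_mul, integral_eval_stdG (f := fun z => (2 * Real.exp |z| / 2 ^ b) ^ 2)
      (by fun_prop) j] at h2
    have h3 := integral_quantErr_bound_le b
    have h4 : 240 / (2 ^ b : ℝ) ^ 2 = 4 * (60 / (2 ^ b) ^ 2) := by ring
    linarith
  have hsum : ∑ j, ∫ g, ε j g ∂(stdG d) ≤ 80 := by
    rw [← integral_finsetSum _ fun j _ => iε j]
    exact (integral_mono (integrable_finsetSum _ fun j _ => iε j) iN hεsum).trans bN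
  have hfin := Finset.sum_le_sum fun j (_ : j ∈ Finset.univ) => hI_le j
  rw [Finset.sum_add_distrib, ← Finset.mul_sum] at hfin
  simp only [Finset.sum_const, Finset.card_univ, Fintype.card_fin, nsmul_eq_mul] at hfin
  have e : 240 / (2 ^ b : ℝ) ^ 2 + 480 / d = (d * (240 / (2 ^ b) ^ 2) + 480) / d := by
    field_simp
  rw [e, le_div_iff₀ hd']
  linarith

/-! ### Concentration of the one-bit QJL estimate -/

lemma exp_le_add_exp_sq (x : ℝ) : Real.exp x ≤ x + Real.exp (x ^ 2) := by
  have h2 := Real.add_one_le_exp (x ^ 2)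
  rcases le_or_gt |x| 1 with h | h
  · have := Real.abs_exp_sub_one_sub_id_le h
    linarith [(abs_le.1 this).2]
  · rcases lt_abs.1 h with h | h
    · have : Real.exp x ≤ Real.exp (x ^ 2) := Real.exp_le_exp.2 (by nlinarith)
      linarith
    · have : Real.exp x ≤ 1 := Real.exp_le_one_iff.2 (by linarith)
      nlinarith

/-- The sign convention of the one-bit code. -/
noncomputable def bitSign (t : ℝ) : ℝ := if 0 ≤ t then 1 else -1

lemma abs_bitSign (t : ℝ) : |bitSign t| = 1 := by
  unfold bitSign; split_ifs <;> simp

lemma mul_bitSign (t : ℝ) : t * bitSign t = |t| := by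
  unfold bitSign
  split_ifs with h
  · rw [mul_one, abs_of_nonneg h]
  · rw [abs_of_neg (not_le.1 h), mul_neg_one]

lemma measurable_bitSign : Measurable bitSign :=
  Measurable.ite measurableSet_Ici measurable_const measurable_const

lemma measurable_inner_mul_bitSign (v r : EuclideanSpace ℝ (Fin d)) :
    Measurable fun g => inner ℝ v g * bitSign (inner ℝ r g) := by
  have := measurable_bitSign
  fun_prop

lemma integrable_inner_mul_bitSign (v r : EuclideanSpace ℝ (Fin d)) :
    Integrable (fun g => inner ℝ v g * bitSign (inner ℝ r g)) (stdG d) := by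
  have h1 : Integrable (fun g => inner ℝ v g) (stdG d) :=
    IsGaussian.integrable_dual (stdG d) (innerSL ℝ v)
  refine h1.mono (measurable_inner_mul_bitSign v r).aestronglyMeasurable
    (Filter.Eventually.of_forall fun g => ?_)
  rw [norm_mul, Real.norm_eq_abs (bitSign _), abs_bitSign, mul_one]

/-- The reflection in the hyperplane orthogonal to `z` preserves the Gaussian measure and fixes `r`,
but reverses the sign of the integrand. -/
lemma integral_inner_mul_bitSign_of_orthogonal {z r : EuclideanSpace ℝ (Fin d)}
    (h : inner ℝ r z = 0) : ∫ g, inner ℝ z g * bitSign (inner ℝ r g) ∂(stdG d) = 0 := by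
  set ρ := Submodule.reflection (ℝ ∙ z)ᗮ with hρ
  have hz : ρ z = -z := Submodule.reflection_orthogonalComplement_singleton_eq_neg z
  have hr : ρ r = r := by
    rw [hρ, Submodule.reflection_eq_self_iff,
      Submodule.mem_orthogonal_singleton_iff_inner_left]
    exact h
  have hadj : ∀ v g, inner ℝ v (ρ g) = inner ℝ (ρ v) g := by
    intro v g
    rw [← ρ.inner_map_map v (ρ g), hρ, Submodule.reflection_reflection]
  have key : ∫ g, inner ℝ z g * bitSign (inner ℝ r g) ∂(stdG d)
      = -∫ g, inner ℝ z g * bitSign (inner ℝ r g) ∂(stdG d) := by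
    nth_rw 1 [stdG]
    rw [← stdGaussian_map ρ, integral_map ρ.continuous.aemeasurable
      (measurable_inner_mul_bitSign z r).aestronglyMeasurable, ← integral_neg]
    simp_rw [hadj, hz, hr, inner_neg_left, neg_mul]
  linarith

/-- Unbiasedness of the one-bit estimate. -/
lemma integral_inner_mul_bitSign (y : EuclideanSpace ℝ (Fin d)) {r : EuclideanSpace ℝ (Fin d)}
    (hr : ‖r‖ = 1) :
    ∫ g, inner ℝ y g * bitSign (inner ℝ r g) ∂(stdG d) = √(2 / Real.pi) * inner ℝ y r := by
  have hy : ∀ g, inner ℝ y g * bitSign (inner ℝ r g)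
      = inner ℝ r y * |inner ℝ r g| + inner ℝ (orthPart r y) g * bitSign (inner ℝ r g) := by
    intro g
    rw [← mul_bitSign, orthPart, inner_sub_left, real_inner_smul_left]
    ring
  have habs : ∫ g, |inner ℝ r g| ∂(stdG d) = √(2 / Real.pi) := by
    rw [← integral_abs_gaussianReal, ← map_inner_stdG hr,
      integral_map (by fun_prop) (by fun_prop)]
  simp_rw [hy]
  rw [integral_add _ (integrable_inner_mul_bitSign _ _),
    integral_inner_mul_bitSign_of_orthogonal (inner_orthPart hr y), integral_const_mul, habs,
    add_zero, mul_comm, real_inner_comm]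
  have h1 := (integrable_inner_mul_bitSign r r).const_mul (inner ℝ r y)
  simpa only [mul_bitSign] using h1

/-- The centered contribution of one row of the Gaussian matrix to the QJL estimate. -/
noncomputable def qjlTerm (y r g : EuclideanSpace ℝ (Fin d)) : ℝ :=
  √(Real.pi / 2) * (inner ℝ y g * bitSign (inner ℝ r g)) - inner ℝ y r

lemma measurable_qjlTerm (y r : EuclideanSpace ℝ (Fin d)) : Measurable (qjlTerm y r) :=
  ((measurable_inner_mul_bitSign y r).const_mul _).sub_const _

lemma integrable_qjlTerm (y r : EuclideanSpace ℝ (Fin d)) : Integrable (qjlTerm y r) (stdG d) :=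
  ((integrable_inner_mul_bitSign y r).const_mul _).sub (integrable_const _)

lemma integral_qjlTerm (y : EuclideanSpace ℝ (Fin d)) {r : EuclideanSpace ℝ (Fin d)}
    (hr : ‖r‖ = 1) : ∫ g, qjlTerm y r g ∂(stdG d) = 0 := by
  unfold qjlTerm
  rw [integral_sub ((integrable_inner_mul_bitSign y r).const_mul _) (integrable_const _),
    integral_const_mul, integral_inner_mul_bitSign y hr, ← mul_assoc,
    ← Real.sqrt_mul (by positivity)]
  have : Real.pi / 2 * (2 / Real.pi) = 1 := by field_simp
  simp [this]

/-- The terms are sub-Gaussian near zero, because `exp t ≤ t + exp (t ^ 2)` and their mean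
vanishes. -/
lemma integrable_and_integral_exp_qjlTerm {y r : EuclideanSpace ℝ (Fin d)} (hy : ‖y‖ = 1)
    (hr : ‖r‖ = 1) {l : ℝ} (hl : |l| ≤ 1 / 4) :
    Integrable (fun g => Real.exp (l * qjlTerm y r g)) (stdG d) ∧
    ∫ g, Real.exp (l * qjlTerm y r g) ∂(stdG d) ≤ Real.exp (8 * l ^ 2) := by
  have hl2 : l ^ 2 ≤ 1 / 16 := by
    rw [← sq_abs]; nlinarith [abs_nonneg l]
  have hyr : |inner ℝ y r| ≤ 1 := by
    have := abs_real_inner_le_norm y r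
    rwa [hy, hr, one_mul] at this
  have hb : ∀ g, Real.exp (l * qjlTerm y r g) ≤ l * qjlTerm y r g
      + Real.exp (2 * l ^ 2) * Real.exp (4 * l ^ 2 * inner ℝ y g ^ 2) := by
    intro g
    refine (exp_le_add_exp_sq _).trans ?_
    rw [← Real.exp_add]
    gcongr
    have h1 : qjlTerm y r g ^ 2 ≤ 4 * inner ℝ y g ^ 2 + 2 := by
      have hs : bitSign (inner ℝ r g) ^ 2 = 1 := by rw [← sq_abs, abs_bitSign, one_pow]
      have h2 : (√(Real.pi / 2) * (inner ℝ y g * bitSign (inner ℝ r g))) ^ 2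
          = Real.pi / 2 * inner ℝ y g ^ 2 := by
        rw [mul_pow, mul_pow, hs, Real.sq_sqrt (by positivity), mul_one]
      have h3 : (inner ℝ y r : ℝ) ^ 2 ≤ 1 := by
        rw [← sq_abs]; nlinarith [abs_nonneg (inner ℝ y r : ℝ)]
      unfold qjlTerm
      have := Real.pi_lt_four
      nlinarith [sq_nonneg (√(Real.pi / 2) * (inner ℝ y g * bitSign (inner ℝ r g))
        + inner ℝ y r), sq_nonneg (inner ℝ y g : ℝ)]
    rw [mul_pow]
    nlinarith [sq_nonneg l]
  have i1 : Integrable (fun g => Real.exp (4 * l ^ 2 * inner ℝ y g ^ 2)) (stdG d) := by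
    have := integrable_exp_mul_sq (l := 4 * l ^ 2) (by linarith)
    rw [← map_inner_stdG hy] at this
    exact this.comp_measurable (by fun_prop)
  have e1 : ∫ g, Real.exp (4 * l ^ 2 * inner ℝ y g ^ 2) ∂(stdG d)
      ≤ Real.exp (4 * l ^ 2 + 2 * (4 * l ^ 2) ^ 2) := by
    have h := integral_exp_mul_sq (l := 4 * l ^ 2) (by linarith)
    rw [← map_inner_stdG hy, integral_map (by fun_prop) (by fun_prop)] at h
    rw [h]
    exact inv_sqrt_one_sub_le (by rw [abs_of_nonneg (by positivity)]; linarith)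
  have i0 := (integrable_qjlTerm y r).const_mul l
  have iR := i0.add (i1.const_mul (Real.exp (2 * l ^ 2)))
  have iL : Integrable (fun g => Real.exp (l * qjlTerm y r g)) (stdG d) :=
    iR.mono' ((measurable_qjlTerm y r).const_mul l).exp.aestronglyMeasurable
      (Filter.Eventually.of_forall fun g => by
        rw [Real.norm_of_nonneg (Real.exp_pos _).le]; exact hb g)
  refine ⟨iL, (integral_mono iL iR hb).trans ?_⟩
  simp only [Pi.add_apply]
  rw [integral_add i0 (i1.const_mul _), integral_const_mul, integral_qjlTerm y hr,
    integral_const_mul, mul_zero, zero_add]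
  calc _ ≤ Real.exp (2 * l ^ 2) * Real.exp (4 * l ^ 2 + 2 * (4 * l ^ 2) ^ 2) := by gcongr
    _ = Real.exp (2 * l ^ 2 + (4 * l ^ 2 + 2 * (4 * l ^ 2) ^ 2)) := (Real.exp_add _ _).symm
    _ ≤ _ := by
      gcongr
      nlinarith [sq_nonneg l]

instance : IsProbabilityMeasure (gaussianMatrix d) := by
  unfold gaussianMatrix; infer_instance

lemma gaussianMatrix_qjlTerm_tail {y r : EuclideanSpace ℝ (Fin d)} (hy : ‖y‖ = 1)
    (hr : ‖r‖ = 1) {s : ℝ} (hs : 0 < s) (hsd : 2 * s ≤ d) :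
    (gaussianMatrix d).real {S | √(32 * s / d) * d < |∑ i, qjlTerm y r (WithLp.toLp 2 (S i))|}
      ≤ 2 * Real.exp (-s) := by
  have hd : (0 : ℝ) < d := by linarith
  set t := √(32 * s / d) with ht
  have ht0 : 0 < t := Real.sqrt_pos.2 (by positivity)
  have ht2 : t ^ 2 = 32 * s / d := Real.sq_sqrt (by positivity)
  have ht4 : t ≤ 4 := by
    rw [ht, Real.sqrt_le_left (by norm_num), div_le_iff₀ hd]; linarith
  have key : ∀ l : ℝ, |l| = t / 16 → (gaussianMatrix d).real
      {S | |l| * t * d ≤ ∑ i, l * qjlTerm y r (WithLp.toLp 2 (S i))} ≤ Real.exp (-s) := by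
    intro l hl
    obtain ⟨i1, b1⟩ := integrable_and_integral_exp_qjlTerm hy hr (l := l) (by linarith)
    have hm := ((measurable_qjlTerm y r).const_mul l).exp
    rw [stdG, ← map_pi_eq_stdGaussian] at i1 b1
    rw [integrable_map_measure hm.aestronglyMeasurable (by fun_prop)] at i1
    rw [integral_map (by fun_prop) hm.aestronglyMeasurable] at b1
    have h := chernoff_pi (ι := Fin d)
      (f := fun w : Fin d → ℝ => l * qjlTerm y r (WithLp.toLp 2 w)) i1 b1 (|l| * t * d)
    refine h.trans (le_of_eq ?_)
    congr 1
    rw [Fintype.card_fin, ← sq_abs l, hl]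
    have : d * t ^ 2 = 32 * s := by rw [ht2]; field_simp
    linear_combination (-1 / 32) * this
  have h1 := key (t / 16) (abs_of_pos (by positivity))
  have h2 := key (-(t / 16)) (by rw [abs_neg]; exact abs_of_pos (by positivity))
  refine (measureReal_mono (s₂ := {S | |t / 16| * t * d ≤
      ∑ i, t / 16 * qjlTerm y r (WithLp.toLp 2 (S i))} ∪ {S | |-(t / 16)| * t * d ≤
      ∑ i, -(t / 16) * qjlTerm y r (WithLp.toLp 2 (S i))}) fun S hS => ?_).trans
    ((measureReal_union_le _ _).trans (by linarith))
  simp only [Set.mem_ofPred_eq, Set.mem_union, ← Finset.mul_sum] at hS ⊢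
  rw [abs_neg, abs_of_pos (by positivity : 0 < t / 16)]
  rcases lt_abs.1 hS with h | h
  · left; nlinarith
  · right; nlinarith

lemma qjlIP_sub_eq (S : Fin d → Fin d → ℝ) (y : EuclideanSpace ℝ (Fin d))
    {r : EuclideanSpace ℝ (Fin d)} (hr : r ≠ 0) (hd : 0 < d) :
    qjlIP S y r - inner ℝ y r
      = ‖r‖ / d * ∑ i, qjlTerm y (direction r) (WithLp.toLp 2 (S i)) := by
  have hd' : (d : ℝ) ≠ 0 := by exact_mod_cast hd.ne'
  have hn : 0 < ‖r‖ := norm_pos_iff.2 hr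
  have hinner : ∀ (v : EuclideanSpace ℝ (Fin d)) i,
      inner ℝ v (WithLp.toLp 2 (S i)) = ∑ k, S i k * v k := fun v i => by
    simp [PiLp.inner_apply]
  have hsign : ∀ i, bitSign (inner ℝ (direction r) (WithLp.toLp 2 (S i)))
      = if qjlEncode S r i then 1 else -1 := by
    intro i
    rw [direction, real_inner_smul_left, hinner, bitSign, qjlEncode]
    simp only [decide_eq_true_eq]
    congr 1
    rw [mul_nonneg_iff_of_pos_left (inv_pos.2 hn)]
  simp only [qjlTerm, hsign]
  simp only [hinner, Finset.sum_sub_distrib, ← Finset.mul_sum, Finset.sum_const,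
    Finset.card_univ, Fintype.card_fin, nsmul_eq_mul, qjlIP]
  rw [direction, real_inner_smul_right]
  field_simp

/-- Concentration of the QJL estimate of a fixed inner product. -/
lemma gaussianMatrix_qjlIP_tail {y : EuclideanSpace ℝ (Fin d)} (hy : ‖y‖ = 1)
    (r : EuclideanSpace ℝ (Fin d)) {s : ℝ} (hs : 0 < s) (hsd : 2 * s ≤ d) :
    (gaussianMatrix d).real {S | √(32 * s / d) * ‖r‖ < |qjlIP S y r - inner ℝ y r|}
      ≤ 2 * Real.exp (-s) := by
  have hd : (0 : ℝ) < d := by linarith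
  by_cases h0 : r = 0
  · simp only [h0, qjlIP, norm_zero, mul_zero, zero_mul, inner_zero_right, sub_zero, abs_zero,
      lt_self_iff_false, Set.ofPred_false, measureReal_empty]
    positivity
  have hn : 0 < ‖r‖ := norm_pos_iff.2 h0
  refine (measureReal_mono fun S hS => ?_).trans
    (gaussianMatrix_qjlTerm_tail hy (norm_direction h0) hs hsd)
  simp only [Set.mem_ofPred_eq] at hS ⊢
  rw [qjlIP_sub_eq S y h0 (by exact_mod_cast hd), abs_mul, abs_of_pos (by positivity)] at hS
  have h2 : √(32 * s / d) * ‖r‖ = ‖r‖ / d * (√(32 * s / d) * d) := by field_simp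
  rw [h2] at hS
  exact lt_of_mul_lt_mul_left hS (by positivity)

/-! ### The error of TurboQuant -/

lemma measureReal_prod_le_of_section {α β : Type*} [MeasurableSpace α] [MeasurableSpace β]
    {μ : Measure α} {ν : Measure β} [IsProbabilityMeasure μ] [IsProbabilityMeasure ν]
    {A : Set (α × β)} (hA : MeasurableSet A) {B : ℝ} (h : ∀ a, ν.real {b | (a, b) ∈ A} ≤ B) :
    (μ.prod ν).real A ≤ B := by
  have : Nonempty α := nonempty_of_isProbabilityMeasure μ
  have hB : 0 ≤ B := measureReal_nonneg.trans (h (Classical.arbitrary α))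
  refine ENNReal.toReal_le_of_le_ofReal hB ?_
  rw [Measure.prod_apply hA]
  calc _ ≤ ∫⁻ _a, ENNReal.ofReal B ∂μ := lintegral_mono fun a => by
        rw [← ENNReal.ofReal_toReal (measure_ne_top ν _)]
        exact ENNReal.ofReal_le_ofReal (h a)
    _ = _ := by simp

lemma measurable_qjlIP {α : Type*} [MeasurableSpace α] (y : EuclideanSpace ℝ (Fin d))
    {S : α → Fin d → Fin d → ℝ} {r : α → EuclideanSpace ℝ (Fin d)} (hS : Measurable S)
    (hr : Measurable r) : Measurable fun p => qjlIP (S p) y (r p) := by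
  have hSik : ∀ i k, Measurable fun p => S p i k := fun i k => by fun_prop
  have hsum : ∀ i, Measurable fun p => bitSign (∑ k, S p i k * r p k) := fun i =>
    measurable_bitSign.comp (Finset.measurable_sum _ fun k _ => by fun_prop)
  have e : (fun p => qjlIP (S p) y (r p)) = fun p => √(Real.pi / 2) / d * ‖r p‖ *
      ∑ i, (∑ k, S p i k * y k) * bitSign (∑ k, S p i k * r p k) := by
    ext p
    simp only [qjlIP, qjlEncode, bitSign, decide_eq_true_eq]
  rw [e]
  fun_prop

lemma one_le_log_four_div {δ : ℝ} (hδ : 0 < δ) (hδ1 : δ < 1) : 1 ≤ Real.log (4 / δ) := by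
  rw [Real.le_log_iff_exp_le (by positivity), le_div_iff₀ hδ]
  have := Real.exp_one_lt_d9
  nlinarith

lemma measurable_residual {α : Type*} [MeasurableSpace α] {K : ℕ} (a : Fin K → ℝ)
    {enc : ℝ → Fin K} (henc : Measurable enc) (x : EuclideanSpace ℝ (Fin d))
    {f : α → OrthGroup d} (hf : Measurable f) : Measurable fun p => x - rawRec a enc (f p) x := by
  simp_rw [rawRec_eq]
  have h1 : Measurable fun p => rot (f p) x := hf.rot measurable_const
  have h2 : Measurable fun p => quantVec a enc (rot (f p) x) :=
    (measurable_quantVec a henc).comp h1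
  exact (hf.rotInv h2).const_sub x

/-- The QJL error for the residual of the rotated and quantized `x`: given the rotation, the residual
is a fixed vector. -/
lemma prod_qjlIP_residual_tail {K : ℕ} (a : Fin K → ℝ) {enc : ℝ → Fin K} (henc : Measurable enc)
    (x : EuclideanSpace ℝ (Fin d)) {y : EuclideanSpace ℝ (Fin d)} (hy : ‖y‖ = 1) {s : ℝ}
    (hs : 0 < s) (hsd : 2 * s ≤ d) :
    ((haarO d).prod (gaussianMatrix d)).real {p | √(32 * s / d) * ‖x - rawRec a enc p.1 x‖
      < |qjlIP p.2 y (x - rawRec a enc p.1 x) - inner ℝ y (x - rawRec a enc p.1 x)|}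
      ≤ 2 * Real.exp (-s) := by
  have hres : Measurable fun p : OrthGroup d × (Fin d → Fin d → ℝ) => x - rawRec a enc p.1 x :=
    measurable_residual a henc x measurable_fst
  have hq : Measurable fun p : OrthGroup d × (Fin d → Fin d → ℝ) =>
      qjlIP p.2 y (x - rawRec a enc p.1 x) := measurable_qjlIP y measurable_snd hres
  refine measureReal_prod_le_of_section ?_ fun R => ?_
  · have h1 : Measurable fun p : OrthGroup d × (Fin d → Fin d → ℝ) =>
        √(32 * s / d) * ‖x - rawRec a enc p.1 x‖ := hres.norm.const_mul _
    have h2 : Measurable fun p : OrthGroup d × (Fin d → Fin d → ℝ) =>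
        |qjlIP p.2 y (x - rawRec a enc p.1 x) - inner ℝ y (x - rawRec a enc p.1 x)| :=
      (hq.sub (hres.const_inner (c := y))).abs
    exact measurableSet_lt h1 h2
  · exact gaussianMatrix_qjlIP_tail hy (x - rawRec a enc R x) hs hsd

/-- The constant of the residual bound for TurboQuant. -/
noncomputable def turboConst : ℝ := √((1 + momentConst 720) * 480 + 32) + 4

/-- The error bound of TurboQuant. The Gaussian mean squared error of the codebook is at most
`240 / 4 ^ (b - 1) + 480 / d`, and the second summand is absorbed by `log (4 / δ) / d`. -/
lemma turboErrorBound_main {δ : ℝ} (hδ : 0 < δ) (hδ1 : δ < 1)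
    (hL : Real.log (4 / δ) ≤ 1 / 10 ^ 6 * d) (b : ℕ) :
    TurboErrorBound d b
      (8 * turboConst *
        (((2 : ℝ) ^ (b - 1))⁻¹ * √(Real.log (4 / δ) / d) + Real.log (4 / δ) / d)) δ := by
  intro a enc hcode x y hx hy
  generalize b - 1 = β at *
  have hL1 := one_le_log_four_div hδ hδ1
  set L := Real.log (4 / δ) with hLdef
  have hd : (0 : ℝ) < d := by linarith
  have hdn : 0 < d := by exact_mod_cast hd
  have hd1 : (1 : ℝ) ≤ d := by exact_mod_cast hdn
  have hr : 0 < √(d : ℝ) := Real.sqrt_pos.2 hd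
  have hm := hcode.gaussian_mse_le hdn
  obtain ⟨-, henc⟩ := hcode
  have hK1 : (1 : ℝ) ≤ 2 ^ β := one_le_pow₀ (by norm_num)
  have hM : 240 / (2 ^ β : ℝ) ^ 2 + 480 / d ≤ 720 := by
    have h1 : 240 / (2 ^ β : ℝ) ^ 2 ≤ 240 := div_le_self (by norm_num) (one_le_pow₀ hK1)
    have h2 : 480 / (d : ℝ) ≤ 480 := div_le_self (by norm_num) hd1
    linarith
  have hκ := momentConst_pos 720
  have t1 := haarO_residual_tail henc (q := fun i => √d * a i) (fun i => by field_simp) hm hM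
    (l := 1 / 16) (by norm_num) le_rfl (s := 2 * L) (by linarith) (by linarith) hx
  have t2 := prod_qjlIP_residual_tail a henc.1 x hy (s := 2 * L) (by linarith) (by linarith)
  rw [exp_neg_two_mul_log hδ] at t1 t2
  set c := √((1 + 16 * momentConst 720 * (1 / 16)) * (240 / (2 ^ β) ^ 2 + 480 / d)
    + 2 * L / (1 / 16 * d)) + √(8 * (2 * L) / d) with hc
  have q0 := Real.sqrt_nonneg (L / d)
  have q2 : √(L / d) ^ 2 = L / d := Real.sq_sqrt (by positivity)
  have qc : ∀ c : ℝ, 0 ≤ c → √(c ^ 2 * (L / d)) = c * √(L / d) := fun c hc => by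
    rw [Real.sqrt_mul (by positivity), Real.sqrt_sq hc]
  have e8 : √(8 * (2 * L) / d) = 4 * √(L / d) := by
    rw [← qc 4 (by norm_num)]; congr 1; ring
  have e32 : √(32 * (2 * L) / d) = 8 * √(L / d) := by
    rw [← qc 8 (by norm_num)]; congr 1; ring
  have hkinv : (0 : ℝ) < (2 ^ β)⁻¹ := by positivity
  have hcle : c ≤ turboConst * ((2 ^ β)⁻¹ + √(L / d)) := by
    set W := (1 + momentConst 720) * 480 + 32 with hW
    have hW0 : 0 ≤ W := by positivity
    have : √((1 + 16 * momentConst 720 * (1 / 16)) * (240 / (2 ^ β) ^ 2 + 480 / d)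
        + 2 * L / (1 / 16 * d)) ≤ √W * ((2 ^ β)⁻¹ + √(L / d)) := by
      rw [Real.sqrt_le_left (by positivity), mul_pow, Real.sq_sqrt hW0]
      have e1 : 2 * L / (1 / 16 * d) = 32 * (L / d) := by field_simp; norm_num
      have e2 : 240 / (2 ^ β : ℝ) ^ 2 = 240 * ((2 ^ β)⁻¹) ^ 2 := by field_simp
      have e3 : 480 / (d : ℝ) ≤ 480 * (L / d) := by
        rw [← mul_div_assoc]; gcongr; linarith
      have hLd0 : 0 ≤ L / d := by positivity
      calc _ ≤ (1 + momentConst 720) * (480 * ((2 ^ β : ℝ)⁻¹) ^ 2 + 480 * (L / d))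
            + 32 * (L / d) := by
            rw [e1, e2]
            have : 1 + 16 * momentConst 720 * (1 / 16) = 1 + momentConst 720 := by ring
            rw [this]
            gcongr
            norm_num
        _ ≤ W * (((2 ^ β : ℝ)⁻¹) ^ 2 + L / d) := by
            rw [hW]
            nlinarith [sq_nonneg ((2 ^ β : ℝ)⁻¹)]
        _ ≤ _ := by
            gcongr
            nlinarith [mul_pos hkinv hkinv, mul_nonneg hkinv.le q0]
    rw [turboConst, hc, e8, ← hW]
    nlinarith
  refine (measureReal_mono (s₂ := ({R | c < ‖quantVec a enc (rot R x) - rot R x‖} ×ˢ Set.univ) ∪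
      {p | √(32 * (2 * L) / d) * ‖x - rawRec a enc p.1 x‖
      < |qjlIP p.2 y (x - rawRec a enc p.1 x) - inner ℝ y (x - rawRec a enc p.1 x)|})
      fun p hp => ?_).trans ((measureReal_union_le _ _).trans ((add_le_add (le_of_eq ?_) t2).trans
        (?_ : (haarO d).real {R | c < ‖quantVec a enc (rot R x) - rot R x‖} + _ ≤ _)))
  · simp only [Set.mem_ofPred_eq, Set.mem_union, Set.mem_prod, Set.mem_univ, and_true] at hp ⊢
    by_contra! hcon
    obtain ⟨c1, c2⟩ := hcon
    have hN : ‖x - rawRec a enc p.1 x‖ = ‖quantVec a enc (rot p.1 x) - rot p.1 x‖ := by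
      rw [rawRec_eq, norm_sub_rev, ← norm_rot p.1]
      congr 1
      exact ((rotIso p.1).map_sub _ _).trans (by rw [rotIso_apply, rotIso_apply, rot_rotInv])
    have herr : turboIP a enc p.1 p.2 x y - inner ℝ x y
        = qjlIP p.2 y (x - rawRec a enc p.1 x) - inner ℝ y (x - rawRec a enc p.1 x) := by
      rw [turboIP, inner_sub_right, real_inner_comm y x]
      ring
    rw [herr] at hp
    rw [hN] at c2
    have h1 : √(32 * (2 * L) / d) * ‖quantVec a enc (rot p.1 x) - rot p.1 x‖
        ≤ 8 * √(L / d) * (turboConst * ((2 ^ β)⁻¹ + √(L / d))) := by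
      rw [e32]
      gcongr
      exact c1.trans hcle
    have e : 8 * √(L / d) * (turboConst * ((2 ^ β)⁻¹ + √(L / d)))
        = 8 * turboConst * ((2 ^ β)⁻¹ * √(L / d) + L / d) := by
      linear_combination 8 * turboConst * q2
    linarith
  · rw [measureReal_prod_prod, probReal_univ, mul_one]
  · nlinarith

/-! ### From error bounds to bit-widths -/

/-- From the error bound in terms of the bit-width to the bit-width in terms of the error. -/
lemma errorBound_of_bits {Err : ℝ → ℝ → Prop} (hmono : ∀ t t' δ, t ≤ t' → Err t δ → Err t' δ)
    {d β : ℕ} (hd : 0 < d) {C C' c : ℝ} (hC : 0 < C) (hc : 0 < c)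
    (hC1 : 4 * C ^ 2 ≤ C') (hC2 : 2 * C ≤ C') (hC3 : 1 / c ≤ C')
    (hmain : ∀ δ, 0 < δ → δ < 1 → Real.log (4 / δ) ≤ c * d →
      Err (C * (((2 : ℝ) ^ β)⁻¹ * √(Real.log (4 / δ) / d) + Real.log (4 / δ) / d)) δ)
    {ε δ : ℝ} (hε : 0 < ε) (hε1 : ε < 1) (hδ : 0 < δ) (hδ1 : δ < 1)
    (h : C' * Real.log (4 / δ) / d ≤ ε)
    (hβ : 1 / 2 * Real.logb 2 (C' * Real.log (4 / δ) / (d * ε ^ 2)) ≤ β) : Err ε δ := by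
  have hd' : (0 : ℝ) < d := by exact_mod_cast hd
  have hL := log_four_div_pos hδ hδ1
  set L := Real.log (4 / δ)
  have hC' : 0 < C' := by linarith
  have hLd : C' * (L / d) ≤ ε := by rwa [← mul_div_assoc]
  refine hmono _ _ _ ?_ (hmain δ hδ hδ1 ?_)
  · have h1 : C' * L / (d * ε ^ 2) ≤ (2 ^ β) ^ 2 := by
      have h2 : Real.logb 2 (C' * L / (d * ε ^ 2)) ≤ ((2 * β : ℕ) : ℝ) := by
        push_cast; linarith
      rw [Real.logb_le_iff_le_rpow (by norm_num) (by positivity), Real.rpow_natCast] at h2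
      rwa [← pow_mul, mul_comm β]
    have h3 : (2 * C) ^ 2 * (L / d) ≤ (ε * 2 ^ β) ^ 2 := by
      calc _ ≤ C' * (L / d) := by gcongr; linarith
        _ = C' * L / (d * ε ^ 2) * ε ^ 2 := by field_simp
        _ ≤ (2 ^ β) ^ 2 * ε ^ 2 := by gcongr
        _ = _ := by ring
    have h4 : 2 * C * √(L / d) ≤ ε * 2 ^ β := by
      have := Real.sqrt_le_sqrt h3
      rwa [Real.sqrt_mul (by positivity), Real.sqrt_sq (by positivity),
        Real.sqrt_sq (by positivity)] at this
    have h5 : C * ((2 ^ β)⁻¹ * √(L / d)) ≤ ε / 2 := by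
      have : C * ((2 ^ β)⁻¹ * √(L / d)) = (2 * C * √(L / d)) / (2 * 2 ^ β) := by field_simp
      rw [this, div_le_iff₀ (by positivity)]
      linarith
    have h6 : C * (L / d) ≤ ε / 2 := by
      have : 2 * C * (L / d) ≤ C' * (L / d) := by gcongr
      linarith
    linarith
  · rw [← div_le_iff₀ hd']
    have h7 : 1 / c * (L / d) ≤ 1 := by
      have : 1 / c * (L / d) ≤ C' * (L / d) := by gcongr
      linarith
    rwa [one_div, inv_mul_le_iff₀ hc, mul_one] at h7

/-- The three claims for an error predicate `Err d b t δ` at bit-width `b`, of which `b - k` bits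
are spent on the quantization, from the first one. -/
lemma exists_bits_of_errorBound {Err : ℕ → ℕ → ℝ → ℝ → Prop} {k : ℕ} (hk : k ≤ 1)
    (hmono : ∀ d b t t' δ, t ≤ t' → Err d b t δ → Err d b t' δ) (hzero : ∀ b t δ, Err 0 b t δ)
    {C c : ℝ} (hC : 0 < C) (hc : 0 < c)
    (hmain : ∀ (d : ℕ) (δ : ℝ), 0 < δ → δ < 1 → Real.log (4 / δ) ≤ c * d → ∀ b : ℕ, 1 ≤ b →
      Err d b
        (C * (((2 : ℝ) ^ (b - k))⁻¹ * √(Real.log (4 / δ) / d) + Real.log (4 / δ) / d)) δ) :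
    ∃ C > (0 : ℝ), ∃ c > (0 : ℝ),
      (∀ (d : ℕ) (δ : ℝ), 0 < δ → δ < 1 → Real.log (4 / δ) ≤ c * d → ∀ b : ℕ, 1 ≤ b →
        Err d b
          (C * (((2 : ℝ) ^ (b - k))⁻¹ * √(Real.log (4 / δ) / d) + Real.log (4 / δ) / d)) δ) ∧
      (∀ (d : ℕ) (ε δ : ℝ), 0 < ε → ε < 1 → 0 < δ → δ < 1 → C * Real.log (4 / δ) / d ≤ ε →
        ∀ b : ℕ, 1 ≤ b →
          k + ⌈(1 / 2) * Real.logb 2 (C * Real.log (4 / δ) / (d * ε ^ 2))⌉ ≤ (b : ℤ) →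
            Err d b ε δ) ∧
      (∃ m > (0 : ℝ), ∃ M > (0 : ℝ),
        ∀ (d : ℕ) (ε δ : ℝ), 0 < ε → ε < 1 → 0 < δ → δ ≤ 1 / 2 →
          M * Real.log (1 / δ) / d ≤ ε → 2 ≤ 1 / (d * ε ^ 2) * Real.log (1 / δ) →
            ∃ b₀ : ℕ, 1 ≤ b₀ ∧ m * Real.log (1 / (d * ε ^ 2) * Real.log (1 / δ)) ≤ b₀ ∧
              b₀ ≤ M * Real.log (1 / (d * ε ^ 2) * Real.log (1 / δ)) ∧
              ∀ b : ℕ, b₀ ≤ b → Err d b ε δ) := by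
  set C' := 4 * C ^ 2 + 2 * C + 1 / c + 1 with hC'
  have hc' : 0 < 1 / c := by positivity
  have hCC : 0 < C ^ 2 := by positivity
  have hC'0 : 1 ≤ C' := by linarith
  have part2 : ∀ (d : ℕ) (ε δ : ℝ), 0 < ε → ε < 1 → 0 < δ → δ < 1 →
      C' * Real.log (4 / δ) / d ≤ ε → ∀ b : ℕ, 1 ≤ b →
      k + ⌈(1 / 2) * Real.logb 2 (C' * Real.log (4 / δ) / (d * ε ^ 2))⌉ ≤ (b : ℤ) →
        Err d b ε δ := by
    intro d ε δ hε hε1 hδ hδ1 h b hb hbits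
    rcases Nat.eq_zero_or_pos d with rfl | hd
    · exact hzero b ε δ
    refine errorBound_of_bits (hmono d b) hd (β := b - k) hC hc (by linarith) (by linarith)
      (by linarith) (fun δ h1 h2 h3 => hmain d δ h1 h2 h3 b hb) hε hε1 hδ hδ1 h ?_
    have h1 : ⌈(1 / 2) * Real.logb 2 (C' * Real.log (4 / δ) / (d * ε ^ 2))⌉ ≤ ((b - k : ℕ) : ℤ) := by
      omega
    exact_mod_cast Int.ceil_le.1 h1
  refine ⟨C', by linarith, c, hc, fun d δ h1 h2 h3 b hb => hmono _ _ _ _ _ ?_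
    (hmain d δ h1 h2 h3 b hb), part2, ?_⟩
  · have := log_four_div_pos h1 h2
    gcongr
    linarith
  obtain ⟨l2, hl2def⟩ : ∃ l2, l2 = Real.log 2 := ⟨_, rfl⟩
  have hl2 : 0 < l2 := hl2def ▸ Real.log_pos (by norm_num)
  have hl2' : l2 < 1 := by linarith [Real.log_two_lt_d9]
  have hlC : 0 ≤ Real.log (3 * C') := Real.log_nonneg (by linarith)
  refine ⟨1 / 2, by norm_num,
    3 * C' + (2 / l2 + Real.log (3 * C') / (2 * l2 ^ 2) + 1 / (2 * l2)), by positivity,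
    fun d ε δ hε hε1 hδ hδ1 hM hX => ?_⟩
  have hd : (0 : ℝ) < d := by
    rcases Nat.eq_zero_or_pos d with rfl | hd
    · norm_num at hX
    · exact_mod_cast hd
  set ℓ := Real.log (1 / δ) with hℓ
  have hℓ2 : l2 ≤ ℓ := hl2def ▸ Real.log_le_log (by norm_num) (by rw [le_div_iff₀ hδ]; linarith)
  have hL3 : Real.log (4 / δ) ≤ 3 * ℓ := by
    have : Real.log (4 / δ) = 2 * l2 + ℓ := by
      rw [hℓ, show (4 : ℝ) / δ = 2 ^ 2 * (1 / δ) by ring, Real.log_mul (by norm_num)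
        (by positivity), Real.log_pow, hl2def]
      norm_num
    linarith
  have hL0 := log_four_div_pos hδ (by linarith)
  set X := 1 / (d * ε ^ 2) * ℓ with hXdef
  have hX0 : 0 < X := by linarith
  have hlX : l2 ≤ Real.log X := hl2def ▸ Real.log_le_log (by norm_num) hX
  have hlX0 : 0 ≤ Real.log X := by linarith
  have hℓ0 : 0 ≤ ℓ := by linarith
  set w := 1 / 2 * Real.logb 2 (3 * C' * X) with hw
  have hwe : w = (Real.log (3 * C') + Real.log X) / (2 * l2) := by
    rw [hw, Real.logb, Real.log_mul (by positivity) (by positivity), ← hl2def]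
    field_simp
  have hw0 : 0 ≤ w := by rw [hwe]; positivity
  refine ⟨1 + ⌈w⌉₊, by omega, ?_, ?_, fun b hb => ?_⟩
  · push_cast
    have h1 := Nat.le_ceil w
    have h2 : 1 / 2 * Real.log X ≤ w := by
      rw [hwe, le_div_iff₀ (by positivity)]
      nlinarith
    linarith
  · push_cast
    have h1 := Nat.ceil_lt_add_one hw0
    have hr : 1 ≤ Real.log X / l2 := (one_le_div₀ hl2).2 hlX
    have h2 : Real.log (3 * C') / (2 * l2) ≤ Real.log (3 * C') / (2 * l2 ^ 2) * Real.log X := by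
      have : Real.log (3 * C') / (2 * l2 ^ 2) * Real.log X
          = Real.log (3 * C') / (2 * l2) * (Real.log X / l2) := by field_simp
      rw [this]
      exact le_mul_of_one_le_right (by positivity) hr
    have h3 : 2 ≤ 2 / l2 * Real.log X := by
      have : 2 / l2 * Real.log X = 2 * (Real.log X / l2) := by ring
      linarith
    have h4 : w = Real.log (3 * C') / (2 * l2) + 1 / (2 * l2) * Real.log X := by
      rw [hwe]; ring
    have h5 : 0 ≤ 3 * C' * Real.log X := by positivity
    rw [add_mul, add_mul, add_mul]
    linarith
  · refine part2 d ε δ hε hε1 hδ (by linarith) ?_ b (by omega) ?_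
    · refine le_trans ?_ hM
      gcongr ?_ / _
      have h0 : 0 ≤ (2 / l2 + Real.log (3 * C') / (2 * l2 ^ 2) + 1 / (2 * l2)) * ℓ := by positivity
      nlinarith
    · have h1 : 1 / 2 * Real.logb 2 (C' * Real.log (4 / δ) / (d * ε ^ 2)) ≤ w := by
        rw [hw]
        gcongr
        · norm_num
        · rw [hXdef, div_le_iff₀ (by positivity)]
          have : 3 * C' * (1 / (d * ε ^ 2) * ℓ) * (d * ε ^ 2) = C' * (3 * ℓ) := by field_simp
          rw [this]
          gcongr
      have h2 : ⌈1 / 2 * Real.logb 2 (C' * Real.log (4 / δ) / (d * ε ^ 2))⌉ ≤ (⌈w⌉₊ : ℤ) := by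
        rw [Int.ceil_le]
        exact_mod_cast h1.trans (Nat.le_ceil w)
      omega

lemma not_norm_eq_one_of_dim_zero (x : EuclideanSpace ℝ (Fin 0)) : ‖x‖ ≠ 1 := by
  simp [Subsingleton.elim x 0]

lemma EdenErrorBound.mono {d b : ℕ} {t t' δ : ℝ} (h : t ≤ t') (ht : EdenErrorBound d b t δ) :
    EdenErrorBound d b t' δ := fun a enc hc x y hx hy =>
  (measureReal_mono fun _ hR => lt_of_le_of_lt h hR).trans (ht a enc hc x y hx hy)

lemma TurboErrorBound.mono {d b : ℕ} {t t' δ : ℝ} (h : t ≤ t') (ht : TurboErrorBound d b t δ) :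
    TurboErrorBound d b t' δ := fun a enc hc x y hx hy =>
  (measureReal_mono fun _ hR => lt_of_le_of_lt h hR).trans (ht a enc hc x y hx hy)

theorem theorem3p6 :
    -- unbiased EDEN
    (∃ C > (0 : ℝ), ∃ c > (0 : ℝ),
      (∀ (d : ℕ) (δ : ℝ), 0 < δ → δ < 1 → Real.log (4 / δ) ≤ c * d →
        ∀ b : ℕ, 1 ≤ b →
          EdenErrorBound d b
            (C * (((2 : ℝ) ^ b)⁻¹ * √(Real.log (4 / δ) / d) + Real.log (4 / δ) / d)) δ) ∧
      (∀ (d : ℕ) (ε δ : ℝ), 0 < ε → ε < 1 → 0 < δ → δ < 1 → C * Real.log (4 / δ) / d ≤ ε →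
        ∀ b : ℕ, max 1 ⌈(1 / 2) * Real.logb 2 (C * Real.log (4 / δ) / (d * ε ^ 2))⌉ ≤ (b : ℤ) →
          EdenErrorBound d b ε δ) ∧
      (∃ m > (0 : ℝ), ∃ M > (0 : ℝ),
        ∀ (d : ℕ) (ε δ : ℝ), 0 < ε → ε < 1 → 0 < δ → δ ≤ 1 / 2 →
          M * Real.log (1 / δ) / d ≤ ε → 2 ≤ 1 / (d * ε ^ 2) * Real.log (1 / δ) →
            ∃ b₀ : ℕ, 1 ≤ b₀ ∧ m * Real.log (1 / (d * ε ^ 2) * Real.log (1 / δ)) ≤ b₀ ∧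
              b₀ ≤ M * Real.log (1 / (d * ε ^ 2) * Real.log (1 / δ)) ∧
              ∀ b : ℕ, b₀ ≤ b → EdenErrorBound d b ε δ)) ∧
    -- TurboQuant for inner products
    (∃ C > (0 : ℝ), ∃ c > (0 : ℝ),
      (∀ (d : ℕ) (δ : ℝ), 0 < δ → δ < 1 → Real.log (4 / δ) ≤ c * d →
        ∀ b : ℕ, 1 ≤ b →
          TurboErrorBound d b
            (C * (((2 : ℝ) ^ (b - 1))⁻¹ * √(Real.log (4 / δ) / d) + Real.log (4 / δ) / d)) δ) ∧
      (∀ (d : ℕ) (ε δ : ℝ), 0 < ε → ε < 1 → 0 < δ → δ < 1 → C * Real.log (4 / δ) / d ≤ ε →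
        ∀ b : ℕ,
          1 + max 0 ⌈(1 / 2) * Real.logb 2 (C * Real.log (4 / δ) / (d * ε ^ 2))⌉ ≤ (b : ℤ) →
            TurboErrorBound d b ε δ) ∧
      (∃ m > (0 : ℝ), ∃ M > (0 : ℝ),
        ∀ (d : ℕ) (ε δ : ℝ), 0 < ε → ε < 1 → 0 < δ → δ ≤ 1 / 2 →
          M * Real.log (1 / δ) / d ≤ ε → 2 ≤ 1 / (d * ε ^ 2) * Real.log (1 / δ) →
            ∃ b₀ : ℕ, 1 ≤ b₀ ∧ m * Real.log (1 / (d * ε ^ 2) * Real.log (1 / δ)) ≤ b₀ ∧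
              b₀ ≤ M * Real.log (1 / (d * ε ^ 2) * Real.log (1 / δ)) ∧
              ∀ b : ℕ, b₀ ≤ b → TurboErrorBound d b ε δ)) := by
  constructor
  · obtain ⟨C, hC, c, hc, h1, h2, h3⟩ := exists_bits_of_errorBound (Err := EdenErrorBound) (k := 0)
      (by norm_num) (fun d b t t' δ h => EdenErrorBound.mono h)
      (fun b t δ a enc _ x y hx _ => absurd hx (not_norm_eq_one_of_dim_zero x))
      (C := 2000) (c := 1 / 10 ^ 6) (by norm_num) (by norm_num)
      (fun d δ hδ hδ1 hL b hb => edenErrorBound_main hδ hδ1 hL hb)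
    refine ⟨C, hC, c, hc, h1, fun d ε δ hε hε1 hδ hδ1 h b hb => ?_, h3⟩
    exact h2 d ε δ hε hε1 hδ hδ1 h b (by exact_mod_cast (le_max_left _ _).trans hb)
      (by simpa using (le_max_right _ _).trans hb)
  · have hT : 0 < turboConst := by unfold turboConst; positivity
    obtain ⟨C, hC, c, hc, h1, h2, h3⟩ := exists_bits_of_errorBound (Err := TurboErrorBound) (k := 1)
      le_rfl (fun d b t t' δ h => TurboErrorBound.mono h)
      (fun b t δ a enc _ x y hx _ => absurd hx (not_norm_eq_one_of_dim_zero x))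
      (C := 8 * turboConst) (c := 1 / 10 ^ 6) (by positivity) (by norm_num)
      (fun d δ hδ hδ1 hL b _ => turboErrorBound_main hδ hδ1 hL b)
    refine ⟨C, hC, c, hc, h1, fun d ε δ hε hε1 hδ hδ1 h b hb => ?_, h3⟩
    have hr := le_max_right (0 : ℤ)
      ⌈(1 / 2) * Real.logb 2 (C * Real.log (4 / δ) / (d * ε ^ 2))⌉
    have hl := le_max_left (0 : ℤ)
      ⌈(1 / 2) * Real.logb 2 (C * Real.log (4 / δ) / (d * ε ^ 2))⌉
    exact h2 d ε δ hε hε1 hδ hδ1 h b (by omega) (by push_cast; omega)
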